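/- Let $0<q<1$ and, for a function $f$ on $q^{-2\mathbb Z_+}=\{1,q^{-2},q^{-4},\dots\}$, put $\int_1^\infty f(x)\,d_{q^2}x=(1-q^2)\sum_{k\ge 0}f(q^{-2k})q^{-2k}$. Let $H$ be the Hilbert space of functions $f$ on $q^{-2\mathbb Z_+}$ with $\int_1^\infty|f(x)|^2d_{q^2}x<\infty$. With $(Df)(x)=\dfrac{f(q^{-1}x)-f(qx)}{q^{-1}x-qx}$, the formula $\Box^{(0)}f=D\,x(q^{-1}x-1)\,Df$ defines a bounded linear operator in $H$ (at $x=1$ the undefined value $f(q^2)$ enters with the coefficient $0$). Write $[a]_q=\dfrac{q^{-a}-q^a}{q^{-1}-q}$, $(a;p)_n=\prod_{j=0}^{n-1}(1-ap^j)$, and, for $l\in\mathbb C$, $$\lambda(l)=-\frac{(1-q^{-2l})(1-q^{2l+2})}{(1-q^2)^2},\qquad c(l)=\frac{(q^{2(l+1)};q^2)_\infty^2}{(q^{2(2l+1)};q^2)_\infty\,(q^2;q^2)_\infty},$$ $$f_l(x)={}_3\Phi_2\!\left[{x,\;q^{-2l},\;q^{2(l+1)};\,q^2;\,q^2\atop q^2,\;0}\right],\qquad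 \psi_l(x)=x^l\,{}_2\Phi_1\!\left({q^{-2l},\;q^{-2l};\,q^2;\,q^2x^{-1}\atop q^{-4l}}\right),$$ where ${}_{3}\Phi_2\!\left[{a,b,c;p;z\atop d,e}\right]=\sum_{m\ge0}\frac{(a;p)_m(b;p)_m(c;p)_m}{(p;p)_m(d;p)_m(e;p)_m}z^m$ and ${}_{2}\Phi_1\!\left({a,b;p;z\atop c}\right)=\sum_{m\ge0}\frac{(a;p)_m(b;p)_m}{(p;p)_m(c;p)_m}z^m$. Then for ${\rm Re}\,l\ne-\frac12$ the operator $\Box^{(0)}-\lambda(l)I$ has a bounded inverse in $H$, and this inverse is an integral operator, $((\Box^{(0)}-\lambda(l)I)^{-1}\psi)(x)=\int_1^\infty G(x,\xi,l)\psi(\xi)\,d_{q^2}\xi$ (absolutely convergent), with a unique kernel $G(x,\xi,l)$, $x,\xi\in q^{-2\mathbb Z_+}$, given as follows. 1) For ${\rm Re}\,l<-\frac12$ one has $c(-1-l)[2l+1]_q\neq0$ and $$G(x,\xi,l)=c_1(l)\begin{cases}\psi_l(\xi)f_l(x),&x\le\xi,\\ f_l(\xi)\psi_l(x),&x\ge\xi,\end{cases}\qquad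 c_1(l)=\frac{1}{c(-1-l)[2l+1]_q}.$$ 2) For ${\rm Re}\,l>-\frac12$ one has $c(l)[2l+1]_q\neq0$ and $$G(x,\xi,l)=c_2(l)\begin{cases}\psi_{-1-l}(\xi)f_l(x),&x\le\xi,\\ f_l(\xi)\psi_{-1-l}(x),&x\ge\xi,\end{cases}\qquad c_2(l)=-\frac{1}{c(l)[2l+1]_q}.$$ -/

import Mathlib

open MeasureTheory

noncomputable section

namespace QDisk

/-! Basic hypergeometric notation. -/

/-- The finite `q`-shifted factorial `(a; p)_n`. -/
def qPoch (a p : ℂ) (n : ℕ) : ℂ := ∏ j ∈ Finset.range n, (1 - a * p ^ j)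

/-- The infinite `q`-shifted factorial `(a; p)_∞` (the product converges for `‖p‖ < 1`). -/
def qPochInf (a p : ℂ) : ℂ := ∏' j : ℕ, (1 - a * p ^ j)

/-- The basic hypergeometric series `₂Φ₁(a, b; c; p, z)`. -/
def phi21 (a b c p z : ℂ) : ℂ :=
  ∑' m : ℕ, qPoch a p m * qPoch b p m / (qPoch p p m * qPoch c p m) * z ^ m

/-- The basic hypergeometric series `₃Φ₂(a, b, c; d, e; p, z)`. -/
def phi32 (a b c d e p z : ℂ) : ℂ :=
  ∑' m : ℕ, qPoch a p m * qPoch b p m * qPoch c p m /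
    (qPoch p p m * qPoch d p m * qPoch e p m) * z ^ m

/-- The symmetric `q`-number `[a]_q = (q^{-a} - q^a) / (q^{-1} - q)`. -/
def qNum (q : ℝ) (a : ℂ) : ℂ := ((q : ℂ) ^ (-a) - (q : ℂ) ^ a) / ((q : ℂ)⁻¹ - (q : ℂ))

/-! The geometric lattice `q^{-2ℤ₊}` and the Hilbert space of functions on it. -/

/-- The point `q^{-2k}`. -/
def node (q : ℝ) (k : ℕ) : ℝ := (q ^ (2 * k))⁻¹

/-- The set `q^{-2ℤ₊} = {1, q^{-2}, q^{-4}, …}`. -/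
def lattice (q : ℝ) : Set ℝ := Set.range (node q)

/-- The measure of the Jackson integral
`∫_1^∞ f(x) d_{q²}x = (1 - q²) ∑_{k ≥ 0} f(q^{-2k}) q^{-2k}`. It has a positive atom at each point
of `q^{-2ℤ₊}` and no other mass, so that equality almost everywhere is equality on `q^{-2ℤ₊}`. -/
def jackson (q : ℝ) : Measure ℝ :=
  Measure.sum fun k : ℕ => ENNReal.ofReal ((1 - q ^ 2) * node q k) • Measure.dirac (node q k)

/-- The Hilbert space of the functions on `q^{-2ℤ₊}` that are square integrable for the
Jackson integral. -/
abbrev L2 (q : ℝ) : Type := Lp ℂ 2 (jackson q)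

/-- The `q`-difference operator `(D f)(x) = (f(q⁻¹x) - f(qx)) / (q⁻¹x - qx)`. -/
def qD (q : ℝ) (f : ℝ → ℂ) (x : ℝ) : ℂ :=
  (f (q⁻¹ * x) - f (q * x)) / ((q⁻¹ * x - q * x : ℝ) : ℂ)

/-- The difference expression `D x (q⁻¹x - 1) D f`. On `q^{-2ℤ₊}` it only involves the values of
`f` on `q^{-2ℤ₊}`: at `x = 1` the value `f(q²)` comes with the factor `x - 1 = 0`. -/
def box (q : ℝ) (f : ℝ → ℂ) : ℝ → ℂ :=
  qD q fun x => ((x * (q⁻¹ * x - 1) : ℝ) : ℂ) * qD q f x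

/-- `B` is the radial part `□⁽⁰⁾` of the Laplace-Beltrami operator: the bounded operator
`f ↦ D x (q⁻¹x - 1) D f`. -/
def IsRadialLaplacian (q : ℝ) (B : L2 q →L[ℂ] L2 q) : Prop :=
  ∀ f : L2 q, ⇑(B f) =ᵐ[jackson q] box q f

/-- `R` is the integral operator with kernel `G`:
`(R f)(x) = ∫_1^∞ G(x, ξ) f(ξ) d_{q²}ξ`, with an absolutely convergent integral. -/
def IsIntegralKernel (q : ℝ) (R : L2 q →L[ℂ] L2 q) (G : ℝ → ℝ → ℂ) : Prop :=
  ∀ f : L2 q,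
    (∀ᵐ x ∂jackson q, Integrable (fun ξ => G x ξ * f ξ) (jackson q)) ∧
    ⇑(R f) =ᵐ[jackson q] fun x => ∫ ξ, G x ξ * f ξ ∂jackson q

/-! Eigenvalues, solutions of the eigenvalue equation, and the `c`-function. -/

/-- `λ(l) = -(1 - q^{-2l})(1 - q^{2l+2}) / (1 - q²)²`. -/
def eigenval (q : ℝ) (l : ℂ) : ℂ :=
  -((1 - (q : ℂ) ^ (-2 * l)) * (1 - (q : ℂ) ^ (2 * l + 2))) / (1 - (q : ℂ) ^ 2) ^ 2

/-- `f_l(x) = ₃Φ₂(x, q^{-2l}, q^{2(l+1)}; q², 0; q², q²)`; the sum is finite for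
`x ∈ q^{-2ℤ₊}`. -/
def fSol (q : ℝ) (l : ℂ) (x : ℝ) : ℂ :=
  phi32 (x : ℂ) ((q : ℂ) ^ (-2 * l)) ((q : ℂ) ^ (2 * (l + 1)))
    ((q : ℂ) ^ 2) 0 ((q : ℂ) ^ 2) ((q : ℂ) ^ 2)

/-- `ψ_l(x) = x^l ₂Φ₁(q^{-2l}, q^{-2l}; q^{-4l}; q², q²x⁻¹)`. -/
def psiSol (q : ℝ) (l : ℂ) (x : ℝ) : ℂ :=
  (x : ℂ) ^ l *
    phi21 ((q : ℂ) ^ (-2 * l)) ((q : ℂ) ^ (-2 * l)) ((q : ℂ) ^ (-4 * l))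
      ((q : ℂ) ^ 2) ((q : ℂ) ^ 2 * (x : ℂ)⁻¹)

/-- The `q`-analogue of Harish-Chandra's `c`-function,
`c(l) = (q^{2(l+1)}; q²)_∞² / ((q^{2(2l+1)}; q²)_∞ (q²; q²)_∞)`. -/
def cFun (q : ℝ) (l : ℂ) : ℂ :=
  qPochInf ((q : ℂ) ^ (2 * (l + 1))) ((q : ℂ) ^ 2) ^ 2 /
    (qPochInf ((q : ℂ) ^ (2 * (2 * l + 1))) ((q : ℂ) ^ 2) *
      qPochInf ((q : ℂ) ^ 2) ((q : ℂ) ^ 2))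

/-- `c₁(l) = 1 / (c(-1-l) [2l+1]_q)`. -/
def c₁ (q : ℝ) (l : ℂ) : ℂ := 1 / (cFun q (-1 - l) * qNum q (2 * l + 1))

/-- `c₂(l) = -1 / (c(l) [2l+1]_q)`. -/
def c₂ (q : ℝ) (l : ℂ) : ℂ := -(1 / (cFun q l * qNum q (2 * l + 1)))

end QDisk

end

namespace QDisk

open Filter Topology

/-! With p = q², r = q^{-2l}, s = q^{2(l+1)} one has rs = p and (1-p)²λ(l) = r + s - 1 - p. On the
nodes p^{-k}, the operator □⁽⁰⁾ - λ(l) is, up to the factor (1-p)⁻², a Jacobi-type recursion `jac`,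
and Re l < -1/2 means ‖r‖ < ‖s‖. The resolvent is then found by the classical Green function
construction.

One solution, `polySol` (that is f_l), satisfies the recursion at every node, including the boundary
k = 0 (`jac_polySol`). The other, `decaySol` (that is ψ_l), decays like r^k and satisfies it only
for k ≥ 1 (`jac_decaySol`). Its defect at k = 0 is the residue of ₂Φ₁ at z = 1, computed by Abel's
theorem (`decaySol_boundary`). This defect fixes the Wronskian (`wronskian`), hence the
normalization of the Green function (`jac_green`); `cFun_mul_qNum` identifies it with
c(-1-l)[2l+1]_q.

Boundedness: f_l grows at most like ‖s‖^k (`exists_norm_polySol_le`), so in the weighted ℓ² space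
the kernel is dominated by σ^|j-k| with σ = ‖r‖/√‖p‖ < 1, and a Schur test applies
(`schur_pow_dist`). Injectivity: a homogeneous solution is a multiple of f_l, which is not square
summable because the Wronskian does not vanish (`not_sqSummable_polySol`). Every node is an atom of
the Jackson measure, so testing on point masses determines the kernel (`isIntegralKernel_iff`). The
half-plane Re l > -1/2 follows from the symmetry l ↦ -1-l, which swaps r and s. -/

/-- The three-term difference operator on sequences to which `(1 - p)² (□⁽⁰⁾ - λ)` restricts on the
nodes `p^{-k}`, with `μ = (1 - p)² λ`. -/
def jac (p μ : ℂ) (f : ℕ → ℂ) (k : ℕ) : ℂ :=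
  (1 - p ^ (k + 1)) * (f (k + 1) - f k) - p * (1 - p ^ k) * (f k - f (k - 1)) - μ * f k

/-! ### Shifted factorials: recursions, non-vanishing, infinite products -/

lemma qPoch_zero (a p : ℂ) : qPoch a p 0 = 1 := by simp [qPoch]

lemma qPoch_succ (a p : ℂ) (n : ℕ) : qPoch a p (n + 1) = qPoch a p n * (1 - a * p ^ n) := by
  simp [qPoch, Finset.prod_range_succ]

lemma qPoch_succ' (a p : ℂ) (n : ℕ) : qPoch a p (n + 1) = (1 - a) * qPoch (p * a) p n := by
  simp only [qPoch, Finset.prod_range_succ']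
  rw [mul_comm]
  congr 1
  · simp
  · exact Finset.prod_congr rfl fun i _ => by ring

lemma qPoch_zero_left (p : ℂ) (n : ℕ) : qPoch 0 p n = 1 := by simp [qPoch]

lemma one_sub_pow_succ_ne_zero {p : ℂ} (hp : ‖p‖ < 1) (n : ℕ) : 1 - p ^ (n + 1) ≠ 0 := by
  intro h
  have h1 : ‖p ^ (n + 1)‖ = 1 := by rw [← sub_eq_zero.mp h]; simp
  rw [norm_pow] at h1
  exact absurd h1 (pow_lt_one₀ (norm_nonneg _) hp n.succ_ne_zero).ne

lemma one_sub_mul_pow_ne_zero {a p : ℂ} (ha : ‖a‖ < 1) (hp : ‖p‖ < 1) (n : ℕ) :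
    1 - a * p ^ n ≠ 0 := by
  intro h
  have h1 : ‖a * p ^ n‖ = 1 := by rw [← sub_eq_zero.mp h]; simp
  rw [norm_mul, norm_pow] at h1
  exact absurd h1 (mul_lt_one_of_nonneg_of_lt_one_left (norm_nonneg _) ha
    (pow_le_one₀ (norm_nonneg _) hp.le)).ne

lemma qPoch_ne_zero {a p : ℂ} (ha : ‖a‖ < 1) (hp : ‖p‖ < 1) (n : ℕ) : qPoch a p n ≠ 0 :=
  Finset.prod_ne_zero_iff.mpr fun j _ => one_sub_mul_pow_ne_zero ha hp j

lemma summable_norm_mul_pow {p : ℂ} (hp : ‖p‖ < 1) (a : ℂ) : Summable fun j : ℕ => ‖-(a * p ^ j)‖ := by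
  simp only [norm_neg, norm_mul, norm_pow]
  exact (summable_geometric_of_lt_one (norm_nonneg _) hp).mul_left _

lemma tendsto_qPoch {p : ℂ} (hp : ‖p‖ < 1) (a : ℂ) :
    Tendsto (qPoch a p) atTop (𝓝 (qPochInf a p)) := by
  have := (multipliable_one_add_of_summable (summable_norm_mul_pow hp a)).tendsto_prod_tprod_nat
  simp only [← sub_eq_add_neg] at this
  exact this

lemma qPochInf_ne_zero {a p : ℂ} (ha : ‖a‖ < 1) (hp : ‖p‖ < 1) : qPochInf a p ≠ 0 := by
  have := tprod_one_add_ne_zero_of_summable (f := fun j : ℕ => -(a * p ^ j))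
    (fun j => by rw [← sub_eq_add_neg]; exact one_sub_mul_pow_ne_zero ha hp j)
    (summable_norm_mul_pow hp a)
  simp only [← sub_eq_add_neg] at this
  exact this

lemma qPochInf_eq_mul {p : ℂ} (hp : ‖p‖ < 1) (a : ℂ) :
    qPochInf a p = (1 - a) * qPochInf (p * a) p := by
  have h1 := (tendsto_qPoch hp a).comp (tendsto_add_atTop_nat 1)
  have h2 := (tendsto_qPoch hp (p * a)).const_mul (1 - a)
  refine tendsto_nhds_unique h1 (h2.congr fun n => ?_)
  simp [qPoch_succ']

lemma qPoch_inv_pow_eq_zero {p : ℂ} (hp0 : p ≠ 0) {k m : ℕ} (h : k < m) :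
    qPoch (p ^ k)⁻¹ p m = 0 :=
  Finset.prod_eq_zero (Finset.mem_range.mpr h) (by simp [hp0])

/-! ### The polynomial solution -/

/-- The coefficient of `(x; p)_m` in `₃Φ₂(x, r, s; p, 0; p, p)`. -/
noncomputable def polyCoeff (p r s : ℂ) (m : ℕ) : ℂ := qPoch r p m * qPoch s p m / qPoch p p m ^ 2 * p ^ m

/-- The values of `₃Φ₂(x, r, s; p, 0; p, p)` at `x = p^{-k}`. -/
noncomputable def polySol (p r s : ℂ) (k : ℕ) : ℂ := phi32 (p ^ k)⁻¹ r s p 0 p p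

/-- The series terminates because (p^{-k}; p)_m = 0 for m > k. The cutoff N is left free so that
neighbouring nodes can share one range of summation. -/
lemma polySol_eq_sum {p : ℂ} (hp0 : p ≠ 0) (r s : ℂ) {k N : ℕ} (h : k < N) :
    polySol p r s k = ∑ m ∈ Finset.range N, polyCoeff p r s m * qPoch (p ^ k)⁻¹ p m := by
  rw [polySol, phi32, tsum_eq_sum (s := Finset.range N)]
  · refine Finset.sum_congr rfl fun m _ => ?_
    rw [polyCoeff, qPoch_zero_left]
    ring
  · intro m hm
    rw [qPoch_inv_pow_eq_zero hp0 (by simp at hm; omega)]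
    simp

lemma polySol_zero {p : ℂ} (hp0 : p ≠ 0) (r s : ℂ) : polySol p r s 0 = 1 := by
  rw [polySol_eq_sum hp0 r s zero_lt_one]
  simp [polyCoeff, qPoch_zero]

lemma polyCoeff_succ {p : ℂ} (hp : ‖p‖ < 1) (r s : ℂ) (m : ℕ) :
    polyCoeff p r s (m + 1) * (1 - p ^ (m + 1)) ^ 2 =
      polyCoeff p r s m * ((1 - r * p ^ m) * (1 - s * p ^ m) * p) := by
  have h1 := qPoch_ne_zero hp hp m
  have h2 := one_sub_pow_succ_ne_zero hp m
  rw [polyCoeff, polyCoeff, qPoch_succ, qPoch_succ, qPoch_succ, ← pow_succ']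
  field_simp
  ring

/-- In the basis (x; p)_m the difference operator is bidiagonal. This turns the recursion in k into
a two-term recursion for the coefficients, the one in `polyCoeff_succ`. -/
lemma jac_qPoch_succ {p : ℂ} (hp0 : p ≠ 0) (k m : ℕ) :
    p ^ (m + 1) * jac p 0 (fun k => qPoch (p ^ k)⁻¹ p (m + 1)) k =
      (1 - p ^ (m + 1)) * ((1 - p ^ (m + 2)) * qPoch (p ^ k)⁻¹ p (m + 1)
        - (1 - p ^ (m + 1)) * qPoch (p ^ k)⁻¹ p m) := by
  have e1 : qPoch (p ^ (k + 1))⁻¹ p (m + 1) = (1 - (p ^ (k + 1))⁻¹) * qPoch (p ^ k)⁻¹ p m := by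
    rw [qPoch_succ', pow_succ', mul_inv, mul_inv_cancel_left₀ hp0]
  have e2 := qPoch_succ (p ^ k)⁻¹ p m
  have hk : p ^ k ≠ 0 := pow_ne_zero _ hp0
  -- The factor 1 - p^k is kept so that k = 0, where k - 1 truncates to 0, needs no separate
  -- treatment later.
  have e3 : (1 - p ^ k) * qPoch (p ^ (k - 1))⁻¹ p (m + 1) =
      -(qPoch (p ^ k)⁻¹ p (m + 1) * (p ^ k - p ^ (m + 1))) := by
    cases k with
    | zero => simp [qPoch_succ']
    | succ n =>
      have hn : p ^ n ≠ 0 := pow_ne_zero _ hp0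
      rw [Nat.add_sub_cancel, qPoch_succ' (p ^ (n + 1))⁻¹, pow_succ' p n, mul_inv,
        mul_inv_cancel_left₀ hp0, qPoch_succ]
      field_simp
      ring
  have e5 : jac p 0 (fun k => qPoch (p ^ k)⁻¹ p (m + 1)) k =
      (1 - p ^ (k + 1)) * (qPoch (p ^ (k + 1))⁻¹ p (m + 1) - qPoch (p ^ k)⁻¹ p (m + 1))
      - p * (1 - p ^ k) * qPoch (p ^ k)⁻¹ p (m + 1)
      + p * ((1 - p ^ k) * qPoch (p ^ (k - 1))⁻¹ p (m + 1)) := by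
    simp only [jac]; ring
  rw [e5, e3, e1, e2]
  generalize qPoch (p ^ k)⁻¹ p m = A
  field_simp
  ring

lemma jac_sum (p μ : ℂ) (c : ℕ → ℂ) (f : ℕ → ℕ → ℂ) (s : Finset ℕ) (k : ℕ) :
    jac p μ (fun j => ∑ m ∈ s, c m * f m j) k = ∑ m ∈ s, c m * jac p μ (f m) k := by
  simp only [jac, ← Finset.sum_sub_distrib, Finset.mul_sum]
  exact Finset.sum_congr rfl fun m _ => by ring

/-- The sum telescopes: adding the term of index N + 1 cancels the previous remainder and leaves the
next one. -/
lemma jac_polySol_sum {p r s : ℂ} (hp0 : p ≠ 0) (hp : ‖p‖ < 1) (hrs : r * s = p) (k N : ℕ) :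
    p ^ N * ∑ m ∈ Finset.range (N + 1),
        polyCoeff p r s m * jac p (r + s - 1 - p) (fun k => qPoch (p ^ k)⁻¹ p m) k =
      (1 - r * p ^ N) * (1 - s * p ^ N) * polyCoeff p r s N * qPoch (p ^ k)⁻¹ p N := by
  induction N with
  | zero =>
    simp only [zero_add, Finset.range_one, Finset.sum_singleton, qPoch_zero, jac, pow_zero]
    -- On constants the operator is -μ, which equals (1 - r)(1 - s) since rs = p.
    linear_combination -polyCoeff p r s 0 * hrs
  | succ N ih =>
    rw [Finset.sum_range_succ, mul_add, pow_succ', mul_assoc, ih]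
    have h1 := jac_qPoch_succ hp0 k N
    have h2 := polyCoeff_succ hp r s N
    have h3 : jac p (r + s - 1 - p) (fun k => qPoch (p ^ k)⁻¹ p (N + 1)) k =
      jac p 0 (fun k => qPoch (p ^ k)⁻¹ p (N + 1)) k
        - (r + s - 1 - p) * qPoch (p ^ k)⁻¹ p (N + 1) := by
      simp only [jac]; ring
    rw [h3]
    rw [pow_succ'] at h1
    generalize qPoch (p ^ k)⁻¹ p (N + 1) = X at *
    generalize qPoch (p ^ k)⁻¹ p N = Y at *
    generalize jac p 0 (fun k => qPoch (p ^ k)⁻¹ p (N + 1)) k = J at *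
    linear_combination polyCoeff p r s (N + 1) * h1 - Y * h2 -
      polyCoeff p r s (N + 1) * X * p ^ (2 * N + 2) * hrs

lemma jac_polySol {p r s : ℂ} (hp0 : p ≠ 0) (hp : ‖p‖ < 1) (hrs : r * s = p) (k : ℕ) :
    jac p (r + s - 1 - p) (polySol p r s) k = 0 := by
  -- At N = k + 1 the remainder contains (p^{-k}; p)_{k+1} = 0, and the k + 2 terms suffice to
  -- express the solution at k - 1, k and k + 1.
  have h := jac_polySol_sum hp0 hp hrs k (k + 1)
  rw [← jac_sum, qPoch_inv_pow_eq_zero hp0 k.lt_succ_self, mul_zero] at h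
  have h' := (mul_eq_zero.mp h).resolve_left (pow_ne_zero _ hp0)
  rw [← h']
  simp only [jac]
  rw [polySol_eq_sum hp0 r s (show k + 1 < k + 1 + 1 by omega),
    polySol_eq_sum hp0 r s (show k < k + 1 + 1 by omega),
    polySol_eq_sum hp0 r s (show k - 1 < k + 1 + 1 by omega)]

/-! ### The decaying solution -/

/-- The coefficient of `z^m` in `₂Φ₁(r, r; r²; p, z)`. -/
noncomputable def decayCoeff (p r : ℂ) (m : ℕ) : ℂ :=
  qPoch r p m * qPoch r p m / (qPoch p p m * qPoch (r ^ 2) p m)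

/-- The values of `x^l ₂Φ₁(r, r; r²; p, p x⁻¹)` at `x = p^{-k}`, with `r = p^{-l}`. -/
noncomputable def decaySol (p r : ℂ) (k : ℕ) : ℂ := r ^ k * phi21 r r (r ^ 2) p (p ^ (k + 1))

lemma decayCoeff_succ {p r : ℂ} (hp : ‖p‖ < 1) (hr : ‖r‖ < 1) (m : ℕ) :
    decayCoeff p r (m + 1) * ((1 - p ^ (m + 1)) * (1 - r ^ 2 * p ^ m)) =
      decayCoeff p r m * (1 - r * p ^ m) ^ 2 := by
  have hr2 : ‖r ^ 2‖ < 1 := by rw [norm_pow]; exact pow_lt_one₀ (norm_nonneg _) hr two_ne_zero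
  have h1 := qPoch_ne_zero hp hp m
  have h2 := one_sub_pow_succ_ne_zero hp m
  have h3 := qPoch_ne_zero hr2 hp m
  have h4 := one_sub_mul_pow_ne_zero hr2 hp m
  rw [decayCoeff, decayCoeff, qPoch_succ, qPoch_succ, qPoch_succ, ← pow_succ']
  field_simp

/-- The limit of the coefficients of `₂Φ₁(r, r; r²; p, z)`. -/
noncomputable def decayLim (p r : ℂ) : ℂ :=
  qPochInf r p ^ 2 / (qPochInf p p * qPochInf (r ^ 2) p)

lemma tendsto_decayCoeff {p r : ℂ} (hp : ‖p‖ < 1) (hr : ‖r‖ < 1) :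
    Tendsto (decayCoeff p r) atTop (𝓝 (decayLim p r)) := by
  have hr2 : ‖r ^ 2‖ < 1 := by rw [norm_pow]; exact pow_lt_one₀ (norm_nonneg _) hr two_ne_zero
  rw [decayLim, sq]
  exact ((tendsto_qPoch hp r).mul (tendsto_qPoch hp r)).div
    ((tendsto_qPoch hp p).mul (tendsto_qPoch hp (r ^ 2)))
    (mul_ne_zero (qPochInf_ne_zero hp hp) (qPochInf_ne_zero hr2 hp))

lemma exists_norm_decayCoeff_le {p r : ℂ} (hp : ‖p‖ < 1) (hr : ‖r‖ < 1) :
    ∃ C, ∀ m, ‖decayCoeff p r m‖ ≤ C := by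
  obtain ⟨C, hC⟩ := (tendsto_decayCoeff hp hr).norm.bddAbove_range
  exact ⟨C, fun m => hC ⟨m, rfl⟩⟩

lemma summable_norm_decayCoeff {p r z : ℂ} (hp : ‖p‖ < 1) (hr : ‖r‖ < 1) (hz : ‖z‖ < 1) :
    Summable fun m => ‖decayCoeff p r m * z ^ m‖ := by
  obtain ⟨C, hC⟩ := exists_norm_decayCoeff_le hp hr
  refine Summable.of_nonneg_of_le (fun _ => norm_nonneg _) (fun m => ?_)
    ((summable_geometric_of_lt_one (norm_nonneg z) hz).mul_left C)
  rw [norm_mul, norm_pow]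
  exact mul_le_mul_of_nonneg_right (hC m) (by positivity)

lemma hasSum_phi21 {p r z : ℂ} (hp : ‖p‖ < 1) (hr : ‖r‖ < 1) (hz : ‖z‖ < 1) :
    HasSum (fun m => decayCoeff p r m * z ^ m) (phi21 r r (r ^ 2) p z) :=
  (summable_norm_decayCoeff hp hr hz).of_norm.hasSum

lemma exists_norm_decaySol_le {p r : ℂ} (hp : ‖p‖ < 1) (hr : ‖r‖ < 1) :
    ∃ C, ∀ k, ‖decaySol p r k‖ ≤ C * ‖r‖ ^ k := by
  obtain ⟨C, hC⟩ := exists_norm_decayCoeff_le hp hr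
  refine ⟨C * (1 - ‖p‖)⁻¹, fun k => ?_⟩
  rw [decaySol, norm_mul, norm_pow, mul_comm]
  refine mul_le_mul_of_nonneg_right ?_ (by positivity)
  have h := (hasSum_geometric_of_lt_one (norm_nonneg p) hp).mul_left C
  refine tsum_of_norm_bounded h fun m => ?_
  rw [norm_mul, norm_pow, norm_pow, ← pow_mul]
  refine mul_le_mul (hC m) ?_ (by positivity) ((norm_nonneg _).trans (hC m))
  exact pow_le_pow_of_le_one (norm_nonneg _) hp.le (by nlinarith)

/-- The `q`-difference equation of `₂Φ₁(r, r; r²; p, z)`. -/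
lemma phi21_qdiff {p r z : ℂ} (hp : ‖p‖ < 1) (hr : ‖r‖ < 1) (hz : ‖z‖ < 1) :
    r * (1 - p * z) * (r * phi21 r r (r ^ 2) p (p ^ 2 * z) - phi21 r r (r ^ 2) p (p * z))
      - p * (1 - z) * (r * phi21 r r (r ^ 2) p (p * z) - phi21 r r (r ^ 2) p z)
      = (r ^ 2 + p - r - r * p) * phi21 r r (r ^ 2) p (p * z) := by
  have hz1 : ‖p * z‖ < 1 := by
    rw [norm_mul]; exact mul_lt_one_of_nonneg_of_lt_one_left (norm_nonneg _) hp hz.le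
  have hz2 : ‖p ^ 2 * z‖ < 1 := by
    rw [norm_mul, norm_pow]
    exact mul_lt_one_of_nonneg_of_lt_one_left (by positivity)
      (pow_lt_one₀ (norm_nonneg _) hp two_ne_zero) hz.le
  have h0 := hasSum_phi21 hp hr hz
  have h1 := hasSum_phi21 hp hr hz1
  have h2 := hasSum_phi21 hp hr hz2
  -- `hA` and `hB` are the two sides of the coefficient recursion `decayCoeff_succ`, summed against
  -- powers of z. The factor 1 - p^m kills the term m = 0 of `hA`, so its index can be shifted by
  -- one.
  have hA : HasSum (fun m => decayCoeff p r m * (1 - p ^ m) * (p - r ^ 2 * p ^ m) * z ^ m)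
      (r ^ 2 * phi21 r r (r ^ 2) p (p ^ 2 * z) + p * phi21 r r (r ^ 2) p z
        - (r ^ 2 + p) * phi21 r r (r ^ 2) p (p * z)) := by
    refine (((h2.mul_left (r ^ 2)).add (h0.mul_left p)).sub
      (h1.mul_left (r ^ 2 + p))).congr_fun fun m => ?_
    simp only [mul_pow, ← pow_mul]; ring
  have hB : HasSum (fun m => p * z * (decayCoeff p r m * (1 - r * p ^ m) ^ 2 * z ^ m))
      (p * z * (phi21 r r (r ^ 2) p z - 2 * r * phi21 r r (r ^ 2) p (p * z)
        + r ^ 2 * phi21 r r (r ^ 2) p (p ^ 2 * z))) := by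
    refine HasSum.mul_left _ ?_
    refine ((h0.sub (h1.mul_left (2 * r))).add (h2.mul_left (r ^ 2))).congr_fun fun m => ?_
    simp only [mul_pow, ← pow_mul]; ring
  rw [← hasSum_nat_add_iff' 1] at hA
  simp only [Finset.range_one, Finset.sum_singleton, pow_zero, sub_self, mul_zero, zero_mul,
    sub_zero] at hA
  have h := hA.unique (hB.congr_fun fun m => ?_)
  · linear_combination h
  · have := decayCoeff_succ hp hr m
    linear_combination p * z ^ (m + 1) * this

/-- This is the q-difference equation at z = p^{n+1}. Node 0 is excluded: it would need z = 1, on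
the boundary of the disc of convergence. -/
lemma jac_decaySol {p r s : ℂ} (hp0 : p ≠ 0) (hp : ‖p‖ < 1) (hr : ‖r‖ < 1) (hrs : r * s = p)
    (n : ℕ) : jac p (r + s - 1 - p) (decaySol p r) (n + 1) = 0 := by
  have hz : ‖p ^ (n + 1)‖ < 1 := by
    rw [norm_pow]; exact pow_lt_one₀ (norm_nonneg _) hp n.succ_ne_zero
  have h := phi21_qdiff hp hr hz
  have hr0 : r ≠ 0 := fun h => hp0 (by rw [← hrs, h, zero_mul])
  refine (mul_eq_zero.mp (?_ : r * _ = 0)).resolve_left hr0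
  rw [← pow_add, ← pow_succ'] at h
  simp only [jac, decaySol, Nat.add_sub_cancel]
  rw [show 2 + (n + 1) = n + 1 + 1 + 1 by ring] at h
  generalize phi21 r r (r ^ 2) p (p ^ (n + 1 + 1 + 1)) = a at *
  generalize phi21 r r (r ^ 2) p (p ^ (n + 1 + 1)) = b at *
  generalize phi21 r r (r ^ 2) p (p ^ (n + 1)) = c at *
  linear_combination r ^ (n + 1) * h - r ^ (n + 1) * b * hrs

/-- Abel's limit theorem: (1 - z)₂Φ₁ is the power series of the differences of the coefficients,
whose partial sums are the coefficients themselves and converge. -/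
lemma tendsto_one_sub_mul_phi21 {p r : ℂ} (hp : ‖p‖ < 1) (hr : ‖r‖ < 1) :
    Tendsto (fun z => (1 - z) * phi21 r r (r ^ 2) p z) (map Complex.ofReal (𝓝[<] 1))
      (𝓝 (decayLim p r)) := by
  let g : ℕ → ℂ := fun n => decayCoeff p r n - if n = 0 then 0 else decayCoeff p r (n - 1)
  have hg : ∀ n, ∑ i ∈ Finset.range (n + 1), g i = decayCoeff p r n := by
    intro n
    induction n with
    | zero => simp [g]
    | succ n ih => rw [Finset.sum_range_succ, ih]; simp [g]
  have hlim : Tendsto (fun n => ∑ i ∈ Finset.range n, g i) atTop (𝓝 (decayLim p r)) := by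
    rw [← tendsto_add_atTop_iff_nat 1]
    simpa only [hg] using tendsto_decayCoeff hp hr
  refine (Complex.tendsto_tsum_powerSeries_nhdsWithin_lt hlim).congr' ?_
  rw [EventuallyEq, eventually_map]
  filter_upwards [Ioo_mem_nhdsLT (zero_lt_one' ℝ)] with x hx
  have hz : ‖(x : ℂ)‖ < 1 := by
    rw [Complex.norm_real, Real.norm_of_nonneg hx.1.le]; exact hx.2
  have h0 := hasSum_phi21 hp hr hz
  refine HasSum.tsum_eq ?_
  rw [← hasSum_nat_add_iff' 1] at h0 ⊢
  have h1 := (hasSum_phi21 hp hr hz).mul_left (x : ℂ)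
  have h2 := h0.sub h1
  simp only [Finset.range_one, Finset.sum_singleton, pow_zero, mul_one] at h2 ⊢
  rw [show g 0 = decayCoeff p r 0 by simp [g], show (1 - (x : ℂ)) * phi21 r r (r ^ 2) p x -
    decayCoeff p r 0 = phi21 r r (r ^ 2) p x - decayCoeff p r 0 - x * phi21 r r (r ^ 2) p x by ring]
  refine h2.congr_fun fun m => ?_
  simp [g]; ring

lemma tendsto_phi21_mul {p r y : ℂ} (hp : ‖p‖ < 1) (hr : ‖r‖ < 1) (hy : ‖y‖ < 1) :
    Tendsto (fun z => phi21 r r (r ^ 2) p (y * z)) (map Complex.ofReal (𝓝[<] 1))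
      (𝓝 (phi21 r r (r ^ 2) p y)) := by
  have hc : ContinuousOn (fun z => ∑' m, decayCoeff p r m * (y * z) ^ m)
      (Metric.closedBall (0 : ℂ) 1) := by
    refine continuousOn_tsum (u := fun m => ‖decayCoeff p r m * y ^ m‖) (fun m => by fun_prop)
      (summable_norm_decayCoeff hp hr hy) fun m z hz => ?_
    rw [mul_pow, ← mul_assoc, norm_mul, norm_pow z]
    exact mul_le_of_le_one_right (norm_nonneg _)
      (pow_le_one₀ (norm_nonneg _) (by simpa using hz))
  have h1 := hc 1 (by simp)
  rw [ContinuousWithinAt, mul_one] at h1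
  refine h1.mono_left (tendsto_nhdsWithin_iff.mpr ⟨?_, ?_⟩)
  · exact (Complex.continuous_ofReal.tendsto' 1 1 (by simp)).mono_left nhdsWithin_le_nhds
  · filter_upwards [Ioo_mem_nhdsLT (zero_lt_one' ℝ)] with x hx
    simp [abs_of_pos hx.1, hx.2.le]

/-- Let z → 1⁻ in `phi21_qdiff`. All terms are continuous except (1 - z)₂Φ₁(z), which tends to
`decayLim` and produces the defect of the recursion at node 0. -/
lemma decaySol_boundary {p r s : ℂ} (hp0 : p ≠ 0) (hp : ‖p‖ < 1) (hr : ‖r‖ < 1)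
    (hrs : r * s = p) :
    (1 - p) * (decaySol p r 1 - decaySol p r 0) - (r + s - 1 - p) * decaySol p r 0 =
      -s * decayLim p r := by
  have hp2 : ‖p ^ 2‖ < 1 := by rw [norm_pow]; exact pow_lt_one₀ (norm_nonneg _) hp two_ne_zero
  have hr0 : r ≠ 0 := fun h => hp0 (by rw [← hrs, h, zero_mul])
  have t0 := tendsto_one_sub_mul_phi21 hp hr
  have t1 := tendsto_phi21_mul hp hr hp
  have t2 := tendsto_phi21_mul hp hr hp2
  have tz : Tendsto (fun z : ℂ => z) (map Complex.ofReal (𝓝[<] 1)) (𝓝 1) :=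
    (Complex.continuous_ofReal.tendsto' 1 1 (by simp)).mono_left nhdsWithin_le_nhds
  have L := (((((tz.const_mul p).const_sub 1).const_mul r).mul ((t2.const_mul r).sub t1)).sub
    ((((tz.const_sub 1).mul (t1.const_mul r)).sub t0).const_mul p))
  have R := t1.const_mul (r ^ 2 + p - r - r * p)
  have h := tendsto_nhds_unique (L.congr' ?_) R
  · refine mul_left_cancel₀ hr0 ?_
    simp only [decaySol, pow_one, pow_zero, zero_add, one_add_one_eq_two]
    generalize phi21 r r (r ^ 2) p p = a at *
    generalize phi21 r r (r ^ 2) p (p ^ 2) = b at *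
    linear_combination h - a * hrs + decayLim p r * hrs
  · rw [EventuallyEq, eventually_map]
    filter_upwards [Ioo_mem_nhdsLT (zero_lt_one' ℝ)] with x hx
    have hz : ‖(x : ℂ)‖ < 1 := by
      rw [Complex.norm_real, Real.norm_of_nonneg hx.1.le]; exact hx.2
    rw [← phi21_qdiff hp hr hz]
    ring

/-! ### Wronskian and Green function -/

/-- Two solutions of the recursion have a Wronskian that is multiplied by p at each step; the
initial value comes from the boundary defect. -/
lemma wronskian {p r s : ℂ} (hp0 : p ≠ 0) (hp : ‖p‖ < 1) (hr : ‖r‖ < 1) (hrs : r * s = p)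
    (k : ℕ) :
    (1 - p ^ (k + 1)) * (decaySol p r (k + 1) * polySol p r s k -
      decaySol p r k * polySol p r s (k + 1)) = -(s * decayLim p r) * p ^ k := by
  induction k with
  | zero =>
    have h1 := decaySol_boundary hp0 hp hr hrs
    have h2 := jac_polySol hp0 hp hrs 0
    simp only [jac, polySol_zero hp0, pow_zero, zero_add, pow_one] at h2 ⊢
    linear_combination h1 - decaySol p r 0 * h2
  | succ k ih =>
    have h1 := jac_polySol hp0 hp hrs (k + 1)
    have h2 := jac_decaySol hp0 hp hr hrs k
    simp only [jac, Nat.add_sub_cancel] at h1 h2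
    linear_combination polySol p r s (k + 1) * h2 - decaySol p r (k + 1) * h1 + p * ih

/-- The Green function, up to normalization. -/
noncomputable def green (p r s : ℂ) (j k : ℕ) : ℂ :=
  if j ≤ k then decaySol p r k * polySol p r s j else polySol p r s k * decaySol p r j

lemma jac_green {p r s : ℂ} (hp0 : p ≠ 0) (hp : ‖p‖ < 1) (hr : ‖r‖ < 1) (hrs : r * s = p)
    (j k : ℕ) :
    jac p (r + s - 1 - p) (fun i => green p r s i k) j =
      if j = k then -(s * decayLim p r) * p ^ k else 0 := by
  have h1 := jac_polySol hp0 hp hrs j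
  rcases lt_trichotomy j k with h | rfl | h
  · simp only [jac, green, if_pos h.le, if_pos (show j + 1 ≤ k from h),
      if_pos (show j - 1 ≤ k by omega), if_neg h.ne] at h1 ⊢
    linear_combination decaySol p r k * h1
  · have h2 := wronskian hp0 hp hr hrs j
    simp only [jac, green, if_pos le_rfl, if_neg (show ¬ j + 1 ≤ j by omega),
      if_pos (show j - 1 ≤ j by omega), if_true] at h1 ⊢
    linear_combination h2 + decaySol p r j * h1
  · obtain ⟨n, rfl⟩ : ∃ n, j = n + 1 := ⟨j - 1, by omega⟩
    have h2 := jac_decaySol hp0 hp hr hrs n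
    -- When n = k the definition takes the other branch, but the two branches agree on the diagonal.
    have h3 : green p r s n k = polySol p r s k * decaySol p r n := by
      rw [green]
      split_ifs with h4
      · rw [show n = k by omega, mul_comm]
      · rfl
    simp only [jac, Nat.add_sub_cancel, h3] at h2 ⊢
    simp only [green, if_neg (show ¬ n + 1 + 1 ≤ k by omega), if_neg (show ¬ n + 1 ≤ k by omega),
      if_neg h.ne'] at h2 ⊢
    linear_combination polySol p r s k * h2

/-! ### Growth of the polynomial solution -/

/-- A discrete Gronwall argument. The conditions F ≤ M, U ≤ (1 - α)M are stable under the
unperturbed step since αM + (1 - α)M = M; each perturbation enlarges M by 1 + 3ε/(1 - α), and these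
factors have a bounded product. -/
lemma bounded_of_perturbed_recursion {F U ε : ℕ → ℝ} {α : ℝ} (hF : ∀ k, 0 ≤ F k)
    (hα0 : 0 ≤ α) (hα : α < 1) (hε : ∀ k, 0 ≤ ε k) (hs : Summable ε)
    (h1 : ∀ k, F (k + 1) ≤ α * F k + U k)
    (h2 : ∀ k, U (k + 1) ≤ U k + ε k * (U k + F (k + 1) + F k)) : ∃ M, ∀ k, F k ≤ M := by
  have hα' : 0 < 1 - α := by linarith
  set M0 := F 0 + F 1 + |U 0| / (1 - α) with hM0
  have hM0' : 0 ≤ M0 := by have := hF 0; have := hF 1; positivity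
  let M : ℕ → ℝ := fun k => M0 * ∏ j ∈ Finset.range k, (1 + 3 * ε j / (1 - α))
  have hδ : ∀ k, 0 ≤ 3 * ε k / (1 - α) := fun k => by have := hε k; positivity
  have hMnn : ∀ k, 0 ≤ M k := fun k =>
    mul_nonneg hM0' (Finset.prod_nonneg fun j _ => by linarith [hδ j])
  have key : ∀ k, F k ≤ M k ∧ F (k + 1) ≤ M k ∧ U k ≤ (1 - α) * M k := by
    intro k
    induction k with
    | zero =>
      have hM : M 0 = M0 := by simp [M]
      have ha : 0 ≤ |U 0| / (1 - α) := by positivity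
      refine ⟨by linarith [hF 1], by simp only [zero_add]; linarith [hF 0], ?_⟩
      have : (1 - α) * (|U 0| / (1 - α)) = |U 0| := by field_simp
      rw [hM, hM0, mul_add, this]
      have := mul_nonneg hα'.le (add_nonneg (hF 0) (hF 1))
      linarith [le_abs_self (U 0)]
    | succ k ih =>
      obtain ⟨a, b, c⟩ := ih
      have hM : M (k + 1) = M k * (1 + 3 * ε k / (1 - α)) := by
        simp only [M, Finset.prod_range_succ, mul_assoc]
      have hle : M k ≤ M (k + 1) := by
        rw [hM]; nlinarith [hδ k, hMnn k]
      have hU : U (k + 1) ≤ (1 - α) * M (k + 1) := by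
        have e : (1 - α) * M (k + 1) = (1 - α) * M k + ε k * (3 * M k) := by
          rw [hM]; field_simp
        have hc : (1 - α) * M k ≤ M k := by nlinarith [hMnn k]
        have := mul_le_mul_of_nonneg_left (show U k + F (k + 1) + F k ≤ 3 * M k by linarith) (hε k)
        rw [e]; linarith [h2 k]
      refine ⟨b.trans hle, ?_, hU⟩
      have := mul_le_mul_of_nonneg_left (b.trans hle) hα0
      linarith [h1 (k + 1)]
  refine ⟨M0 * Real.exp (∑' j, 3 * ε j / (1 - α)), fun k => (key k).1.trans ?_⟩
  refine mul_le_mul_of_nonneg_left ?_ hM0'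
  have hsum : Summable fun j => 3 * ε j / (1 - α) := (hs.mul_left 3).div_const _
  calc ∏ j ∈ Finset.range k, (1 + 3 * ε j / (1 - α))
      ≤ ∏ j ∈ Finset.range k, Real.exp (3 * ε j / (1 - α)) :=
        Finset.prod_le_prod (fun j _ => by linarith [hδ j]) fun j _ => by
          rw [add_comm]; exact Real.add_one_le_exp _
    _ = Real.exp (∑ j ∈ Finset.range k, 3 * ε j / (1 - α)) := (Real.exp_sum _ _).symm
    _ ≤ _ := Real.exp_le_exp.mpr (hsum.sum_le_tsum _ fun j _ => hδ j)

lemma exists_norm_polySol_le {p r s : ℂ} (hp0 : p ≠ 0) (hp : ‖p‖ < 1) (hrs : r * s = p)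
    (hlt : ‖r‖ < ‖s‖) : ∃ C, ∀ k, ‖polySol p r s k‖ ≤ C * ‖s‖ ^ k := by
  have hS : 0 < ‖s‖ := (norm_nonneg _).trans_lt hlt
  set f := polySol p r s with hf
  -- As k → ∞ the recursion tends to f(k+2) - (r + s)f(k+1) + rs f(k) = 0, with characteristic roots
  -- r and s. Splitting off the root r leaves u(k+1) = s u(k) with a summable relative error.
  let u : ℕ → ℂ := fun k => f (k + 1) - r * f k
  -- A common bound for the three coefficients of the error term in `hrec` after normalization by
  -- powers of ‖s‖.
  let K : ℝ := 1 + ‖r - 2‖ / ‖s‖ + 1 / ‖s‖ ^ 2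
  have hK1 : 1 ≤ K := by have : 0 ≤ ‖r - 2‖ / ‖s‖ := by positivity
                         have : 0 ≤ 1 / ‖s‖ ^ 2 := by positivity
                         simp only [K]; linarith
  have hK2 : ‖r - 2‖ / ‖s‖ ≤ K := by
    have : 0 ≤ 1 / ‖s‖ ^ 2 := by positivity
    simp only [K]; linarith
  have hK3 : 1 / ‖s‖ ^ 2 ≤ K := by
    have : 0 ≤ ‖r - 2‖ / ‖s‖ := by positivity
    simp only [K]; linarith
  have hpk : ∀ k : ℕ, 1 - ‖p‖ ≤ ‖1 - p ^ (k + 1)‖ := fun k => by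
    have h1 := norm_sub_norm_le (1 : ℂ) (p ^ (k + 1))
    rw [norm_one, norm_pow] at h1
    have h2 : ‖p‖ ^ (k + 1) ≤ ‖p‖ := pow_le_of_le_one (norm_nonneg _) hp.le k.succ_ne_zero
    linarith
  have hrec : ∀ k, u (k + 1) = s * u k +
      p ^ (k + 2) / (1 - p ^ (k + 2)) * (s * u k + (r - 2) * f (k + 1) + f k) := by
    intro k
    have h := jac_polySol hp0 hp hrs (k + 1)
    have h0 := one_sub_pow_succ_ne_zero hp (k + 1)
    simp only [jac, Nat.add_sub_cancel, ← hf] at h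
    rw [show k + 1 + 1 = k + 2 from rfl] at h h0
    simp only [u]
    rw [show k + 1 + 1 = k + 2 from rfl]
    field_simp
    linear_combination h + f k * hrs
  have step1 : ∀ k, ‖f (k + 1)‖ / ‖s‖ ^ (k + 1) ≤
      ‖r‖ / ‖s‖ * (‖f k‖ / ‖s‖ ^ k) + ‖u k‖ / ‖s‖ ^ (k + 1) := by
    intro k
    have h : ‖f (k + 1)‖ ≤ ‖r‖ * ‖f k‖ + ‖u k‖ := by
      rw [← norm_mul]
      refine le_trans (le_of_eq ?_) (norm_add_le _ _)
      simp [u]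
    calc ‖f (k + 1)‖ / ‖s‖ ^ (k + 1) ≤ (‖r‖ * ‖f k‖ + ‖u k‖) / ‖s‖ ^ (k + 1) := by gcongr
      _ = _ := by field_simp; ring
  have step2 : ∀ k, ‖u (k + 1)‖ / ‖s‖ ^ (k + 1 + 1) ≤ ‖u k‖ / ‖s‖ ^ (k + 1) +
      ‖p‖ ^ (k + 2) / (1 - ‖p‖) * K * (‖u k‖ / ‖s‖ ^ (k + 1) +
        ‖f (k + 1)‖ / ‖s‖ ^ (k + 1) + ‖f k‖ / ‖s‖ ^ k) := by
    intro k
    have hq : ‖p ^ (k + 2) / (1 - p ^ (k + 2))‖ ≤ ‖p‖ ^ (k + 2) / (1 - ‖p‖) := by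
      rw [norm_div, norm_pow]
      exact div_le_div_of_nonneg_left (by positivity) (by linarith) (hpk (k + 1))
    have h : ‖u (k + 1)‖ ≤ ‖s‖ * ‖u k‖ +
        ‖p‖ ^ (k + 2) / (1 - ‖p‖) * (‖s‖ * ‖u k‖ + ‖r - 2‖ * ‖f (k + 1)‖ + ‖f k‖) := by
      rw [hrec k]
      refine (norm_add_le _ _).trans ?_
      rw [norm_mul, norm_mul]
      refine add_le_add le_rfl (mul_le_mul hq ?_ (norm_nonneg _) ((norm_nonneg _).trans hq))
      refine (norm_add_le _ _).trans (add_le_add ((norm_add_le _ _).trans ?_) le_rfl)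
      rw [norm_mul, norm_mul]
    have hA : 0 ≤ ‖p‖ ^ (k + 2) / (1 - ‖p‖) := (norm_nonneg _).trans hq
    generalize ‖p‖ ^ (k + 2) / (1 - ‖p‖) = A at *
    have e1 : (‖s‖ * ‖u k‖ + A * (‖s‖ * ‖u k‖ + ‖r - 2‖ * ‖f (k + 1)‖ + ‖f k‖)) / ‖s‖ ^ (k + 1 + 1)
      = ‖u k‖ / ‖s‖ ^ (k + 1) + A * (1 * (‖u k‖ / ‖s‖ ^ (k + 1)) +
        (‖r - 2‖ / ‖s‖) * (‖f (k + 1)‖ / ‖s‖ ^ (k + 1)) + (1 / ‖s‖ ^ 2) * (‖f k‖ / ‖s‖ ^ k)) := by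
      field_simp
      ring
    calc ‖u (k + 1)‖ / ‖s‖ ^ (k + 1 + 1) ≤ _ := by gcongr
      _ = _ := e1
      _ ≤ ‖u k‖ / ‖s‖ ^ (k + 1) + A * (K * (‖u k‖ / ‖s‖ ^ (k + 1)) +
        K * (‖f (k + 1)‖ / ‖s‖ ^ (k + 1)) + K * (‖f k‖ / ‖s‖ ^ k)) := by gcongr
      _ = _ := by ring
  obtain ⟨M, hM⟩ := bounded_of_perturbed_recursion (F := fun k => ‖f k‖ / ‖s‖ ^ k)
    (U := fun k => ‖u k‖ / ‖s‖ ^ (k + 1)) (ε := fun k => ‖p‖ ^ (k + 2) / (1 - ‖p‖) * K)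
    (α := ‖r‖ / ‖s‖) (fun k => by positivity) (by positivity) ((div_lt_one hS).mpr hlt)
    (fun k => by have : 0 < 1 - ‖p‖ := by linarith
                 positivity)
    ((((summable_nat_add_iff 2).mpr
      (summable_geometric_of_lt_one (norm_nonneg p) hp)).div_const _).mul_right _)
    step1 step2
  refine ⟨M, fun k => ?_⟩
  have := hM k
  rwa [div_le_iff₀ (by positivity)] at this

/-! ### Schur test -/

/-- With truncated subtraction, (j - k) + (k - j) is |j - k|, and each distance is attained at most
once on either side of j. -/
lemma tsum_pow_dist_le (σ : ENNReal) (j : ℕ) :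
    ∑' k : ℕ, σ ^ ((j - k) + (k - j)) ≤ 2 * ∑' n : ℕ, σ ^ n := by
  rw [← ENNReal.summable.tsum_add_tsum_compl (s := Set.Iic j) ENNReal.summable, two_mul]
  refine add_le_add ?_ ?_
  · refine ENNReal.tsum_comp_le_tsum_of_injective
      (f := fun k : Set.Iic j => (j - (k : ℕ)) + ((k : ℕ) - j)) ?_ (fun n => σ ^ n)
    rintro ⟨a, ha⟩ ⟨b, hb⟩ h
    simp only [Set.mem_Iic] at ha hb
    simp only at h
    exact Subtype.ext (by simp only; omega)
  · refine ENNReal.tsum_comp_le_tsum_of_injective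
      (f := fun k : ↥(Set.Iic j)ᶜ => (j - (k : ℕ)) + ((k : ℕ) - j)) ?_ (fun n => σ ^ n)
    rintro ⟨a, ha⟩ ⟨b, hb⟩ h
    simp only [Set.mem_compl_iff, Set.mem_Iic, not_le] at ha hb
    simp only at h
    exact Subtype.ext (by simp only; omega)

/-- Weighted Cauchy–Schwarz with a superfluous factor 2: the crude xy ≤ x² + y² holds in `ENNReal`
without any finiteness conditions. -/
lemma sq_tsum_mul_le (K b : ℕ → ENNReal) :
    (∑' k, K k * b k) ^ 2 ≤ 2 * ((∑' k, K k) * ∑' k, K k * b k ^ 2) := by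
  have hxy : ∀ x y : ENNReal, x * y ≤ x ^ 2 + y ^ 2 := by
    intro x y
    rcases le_total x y with h | h
    · calc x * y ≤ y * y := by gcongr
        _ ≤ _ := by rw [sq y]; exact le_add_self
    · calc x * y ≤ x * x := by gcongr
        _ ≤ _ := by rw [sq x]; exact le_self_add
  calc (∑' k, K k * b k) ^ 2 = ∑' i, ∑' k, (K i * b i) * (K k * b k) := by
        rw [sq, ← ENNReal.tsum_mul_right]
        simp_rw [← ENNReal.tsum_mul_left]
    _ ≤ ∑' i, ∑' k, (K i * (K k * b k ^ 2) + (K i * b i ^ 2) * K k) := by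
        refine ENNReal.tsum_le_tsum fun i => ENNReal.tsum_le_tsum fun k => ?_
        calc (K i * b i) * (K k * b k) = (K i * K k) * (b i * b k) := by ring
          _ ≤ (K i * K k) * (b i ^ 2 + b k ^ 2) := by gcongr; exact hxy _ _
          _ = _ := by ring
    _ = _ := by
        simp_rw [ENNReal.tsum_add, ENNReal.tsum_mul_left, ENNReal.tsum_mul_right]
        ring

/-- Schur test: row and column sums of σ^|j-k| are both at most D. Working in `ENNReal` makes the
exchange of sums free, and finiteness of the result yields both summability claims. -/
lemma schur_pow_dist_nnreal {σ : NNReal} (hσ : σ < 1) {a : ℕ → NNReal}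
    (ha : Summable fun k => a k ^ 2) :
    (∀ j, Summable fun k => σ ^ ((j - k) + (k - j)) * a k) ∧
      Summable fun j => (∑' k, σ ^ ((j - k) + (k - j)) * a k) ^ 2 := by
  set D : ENNReal := 2 * ∑' n : ℕ, (σ : ENNReal) ^ n with hD
  have hDtop : D ≠ ⊤ := by
    rw [hD, ENNReal.tsum_geometric]
    refine ENNReal.mul_ne_top (by simp) (ENNReal.inv_ne_top.mpr ?_)
    rw [ne_eq, tsub_eq_zero_iff_le, not_le]
    exact_mod_cast hσ
  have hatop : ∑' k, (a k : ENNReal) ^ 2 ≠ ⊤ := by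
    have := ENNReal.tsum_coe_ne_top_iff_summable.mpr ha
    simpa using this
  have main : ∑' j : ℕ, (∑' k, (σ : ENNReal) ^ ((j - k) + (k - j)) * a k) ^ 2 ≠ ⊤ := by
    refine ne_top_of_le_ne_top (b := 2 * (D * (D * ∑' k, (a k : ENNReal) ^ 2))) ?_ ?_
    · exact ENNReal.mul_ne_top (by simp) (ENNReal.mul_ne_top hDtop (ENNReal.mul_ne_top hDtop hatop))
    · calc ∑' j : ℕ, (∑' k, (σ : ENNReal) ^ ((j - k) + (k - j)) * a k) ^ 2
          ≤ ∑' j : ℕ, 2 * (D * ∑' k, (σ : ENNReal) ^ ((j - k) + (k - j)) * (a k : ENNReal) ^ 2) :=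
            ENNReal.tsum_le_tsum fun j => (sq_tsum_mul_le _ _).trans (by
              gcongr; exact tsum_pow_dist_le _ _)
        _ = 2 * (D * ∑' k, ∑' j : ℕ, (σ : ENNReal) ^ ((j - k) + (k - j)) * (a k : ENNReal) ^ 2) := by
            rw [ENNReal.tsum_mul_left, ENNReal.tsum_mul_left, ENNReal.tsum_comm]
        _ ≤ 2 * (D * ∑' k, D * (a k : ENNReal) ^ 2) := by
            gcongr with k
            rw [ENNReal.tsum_mul_right]
            gcongr
            simp_rw [add_comm (_ - k)]
            exact tsum_pow_dist_le _ _
        _ = _ := by rw [ENNReal.tsum_mul_left]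
  have h1 : ∀ j, Summable fun k => σ ^ ((j - k) + (k - j)) * a k := by
    intro j
    rw [← ENNReal.tsum_coe_ne_top_iff_summable]
    have := ENNReal.ne_top_of_tsum_ne_top main j
    push_cast
    exact fun h => this (by rw [h]; simp)
  refine ⟨h1, ?_⟩
  rw [← ENNReal.tsum_coe_ne_top_iff_summable]
  convert main using 4 with j
  push_cast [ENNReal.coe_tsum (h1 j)]
  rfl

lemma schur_pow_dist {σ : ℝ} (hσ0 : 0 ≤ σ) (hσ : σ < 1) {a : ℕ → ℝ} (ha0 : ∀ k, 0 ≤ a k)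
    (ha : Summable fun k => a k ^ 2) :
    (∀ j, Summable fun k => σ ^ ((j - k) + (k - j)) * a k) ∧
      Summable fun j => (∑' k, σ ^ ((j - k) + (k - j)) * a k) ^ 2 := by
  lift σ to NNReal using hσ0
  lift a to ℕ → NNReal using ha0
  have := schur_pow_dist_nnreal (σ := σ) (a := a) (by exact_mod_cast hσ) (by
    simp only at ha; exact_mod_cast ha)
  simp only
  exact_mod_cast this

/-! ### Square summable sequences -/

/-- Square summability with the weights `‖p‖^{-k}`. -/
def SqSummable (p : ℂ) (f : ℕ → ℂ) : Prop := Summable fun k => (‖p‖ ^ k)⁻¹ * ‖f k‖ ^ 2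

lemma sqSummable_iff {p : ℂ} {f : ℕ → ℂ} :
    SqSummable p f ↔ Summable fun k => (‖f k‖ / √‖p‖ ^ k) ^ 2 := by
  rw [SqSummable]
  refine summable_congr fun k => ?_
  rw [div_pow, ← pow_mul, mul_comm k 2, pow_mul, Real.sq_sqrt (norm_nonneg _)]
  ring

lemma SqSummable.add {p : ℂ} {f g : ℕ → ℂ} (hf : SqSummable p f) (hg : SqSummable p g) :
    SqSummable p fun k => f k + g k := by
  refine Summable.of_nonneg_of_le (fun k => by positivity) (fun k => ?_)
    ((Summable.add hf hg).mul_left 2)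
  have h : ‖f k + g k‖ ^ 2 ≤ 2 * (‖f k‖ ^ 2 + ‖g k‖ ^ 2) := by
    have := norm_add_le (f k) (g k)
    nlinarith [sq_nonneg (‖f k‖ - ‖g k‖), norm_nonneg (f k + g k), norm_nonneg (f k), norm_nonneg (g k)]
  calc (‖p‖ ^ k)⁻¹ * ‖f k + g k‖ ^ 2 ≤ (‖p‖ ^ k)⁻¹ * (2 * (‖f k‖ ^ 2 + ‖g k‖ ^ 2)) := by gcongr
    _ = _ := by ring

lemma SqSummable.mul_bounded {p : ℂ} {f c : ℕ → ℂ} (hf : SqSummable p f) {C : ℝ}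
    (hc : ∀ k, ‖c k‖ ≤ C) : SqSummable p fun k => c k * f k := by
  refine Summable.of_nonneg_of_le (fun k => by positivity) (fun k => ?_) (hf.mul_left (C ^ 2))
  rw [norm_mul, mul_pow, mul_left_comm]
  have := hc k
  gcongr

lemma SqSummable.succ {p : ℂ} (hp0 : p ≠ 0) {f : ℕ → ℂ} (hf : SqSummable p f) :
    SqSummable p fun k => f (k + 1) := by
  have h := ((summable_nat_add_iff 1).mpr hf).mul_left ‖p‖
  refine h.congr fun k => ?_
  have : ‖p‖ ≠ 0 := by simpa
  field_simp
  ring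

lemma SqSummable.pred {p : ℂ} {f : ℕ → ℂ} (hf : SqSummable p f) :
    SqSummable p fun k => f (k - 1) := by
  refine (summable_nat_add_iff 1).mp ?_
  refine (hf.mul_left ‖p‖⁻¹).congr fun k => ?_
  simp only [Nat.add_sub_cancel, pow_succ', mul_inv]
  ring

lemma SqSummable.jac {p : ℂ} (hp0 : p ≠ 0) (hp : ‖p‖ < 1) (μ : ℂ) {f : ℕ → ℂ}
    (hf : SqSummable p f) : SqSummable p (jac p μ f) := by
  have hb : ∀ k : ℕ, ‖1 - p ^ k‖ ≤ 2 := fun k => by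
    refine (norm_sub_le _ _).trans ?_
    rw [norm_one, norm_pow]
    linarith [pow_le_one₀ (n := k) (norm_nonneg p) hp.le]
  have h1 := (hf.succ hp0).mul_bounded (c := fun k => 1 - p ^ (k + 1)) (fun k => hb (k + 1))
  have h2 := hf.pred.mul_bounded (c := fun k => (1 - p ^ k) * p) (C := 2 * ‖p‖)
    (fun k => by rw [norm_mul]; gcongr; exact hb k)
  have h3 := hf.mul_bounded (c := fun k => -(1 - p ^ (k + 1))) (C := 2)
    (fun k => by rw [norm_neg]; exact hb (k + 1))
  have h4 := hf.mul_bounded (c := fun k => (1 - p ^ k) * -p) (C := 2 * ‖p‖)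
    (fun k => by rw [norm_mul, norm_neg]; gcongr; exact hb k)
  have h5 := hf.mul_bounded (c := fun _ => -μ) (C := ‖-μ‖) (fun k => le_rfl)
  convert (((h1.add h2).add h3).add h4).add h5 using 2 with k
  simp only [QDisk.jac]
  ring

/-! ### The resolvent on sequences -/

/-- ‖r‖² < ‖r‖‖s‖ = ‖p‖. The rate √‖p‖ is the threshold for square summability with weights
‖p‖^{-k}. -/
lemma norm_sq_lt {p r s : ℂ} (hp0 : p ≠ 0) (hrs : r * s = p) (hlt : ‖r‖ < ‖s‖) :
    0 < ‖r‖ ∧ ‖r‖ < √‖p‖ := by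
  have hr0 : r ≠ 0 := fun h => hp0 (by rw [← hrs, h, zero_mul])
  have : 0 < ‖r‖ := by simpa
  refine ⟨this, Real.lt_sqrt_of_sq_lt ?_⟩
  rw [← hrs, norm_mul, sq]
  gcongr

lemma decayLim_ne_zero {p r : ℂ} (hp : ‖p‖ < 1) (hr : ‖r‖ < 1) : decayLim p r ≠ 0 := by
  have hr2 : ‖r ^ 2‖ < 1 := by rw [norm_pow]; exact pow_lt_one₀ (norm_nonneg _) hr two_ne_zero
  exact div_ne_zero (pow_ne_zero _ (qPochInf_ne_zero hr hp))
    (mul_ne_zero (qPochInf_ne_zero hp hp) (qPochInf_ne_zero hr2 hp))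

lemma norm_lt_one_of_lt {p r s : ℂ} (hp0 : p ≠ 0) (hp : ‖p‖ < 1) (hrs : r * s = p)
    (hlt : ‖r‖ < ‖s‖) : ‖r‖ < 1 :=
  (norm_sq_lt hp0 hrs hlt).2.trans (by rw [Real.sqrt_lt' one_pos]; simpa using hp)

/-- Otherwise `polySol` would be o(√‖p‖^k); as `decaySol` is O(√‖p‖^k), the Wronskian would be
o(‖p‖^k), whereas it is a nonzero constant times p^k. -/
lemma not_sqSummable_polySol {p r s : ℂ} (hp0 : p ≠ 0) (hp : ‖p‖ < 1) (hrs : r * s = p)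
    (hlt : ‖r‖ < ‖s‖) : ¬ SqSummable p (polySol p r s) := by
  intro h
  obtain ⟨hR, hRt⟩ := norm_sq_lt hp0 hrs hlt
  have hr := norm_lt_one_of_lt hp0 hp hrs hlt
  obtain ⟨C, hC⟩ := exists_norm_decaySol_le hp hr
  set t := √‖p‖ with ht
  have ht0 : 0 < t := hR.trans hRt
  have ht2 : t ^ 2 = ‖p‖ := Real.sq_sqrt (norm_nonneg _)
  have hC0 : 0 ≤ C := by simpa using (norm_nonneg _).trans (hC 0)
  have he : Tendsto (fun k => ‖polySol p r s k‖ / t ^ k) atTop (𝓝 0) := by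
    have h1 := (sqSummable_iff.mp h).tendsto_atTop_zero.sqrt
    rw [Real.sqrt_zero] at h1
    exact h1.congr fun k => Real.sqrt_sq (by positivity)
  have he' := he.comp (tendsto_add_atTop_nat 1)
  have hlim := (he.add he').const_mul (2 * C * t)
  rw [add_zero, mul_zero] at hlim
  have hW : ‖s * decayLim p r‖ ≤ 0 := by
    refine ge_of_tendsto' hlim fun k => ?_
    have hw := congrArg norm (wronskian hp0 hp hr hrs k)
    rw [norm_mul, norm_mul, norm_neg, norm_pow, ← ht2] at hw
    have b1 : ‖1 - p ^ (k + 1)‖ ≤ 2 := by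
      refine (norm_sub_le _ _).trans ?_
      rw [norm_one, norm_pow]
      linarith [pow_le_one₀ (n := k + 1) (norm_nonneg p) hp.le]
    have b2 : ∀ n, ‖decaySol p r n‖ ≤ C * t ^ n := fun n => (hC n).trans (by gcongr)
    have b3 : ‖decaySol p r (k + 1) * polySol p r s k - decaySol p r k * polySol p r s (k + 1)‖ ≤
        C * t ^ (k + 1) * ‖polySol p r s k‖ + C * t ^ k * ‖polySol p r s (k + 1)‖ := by
      refine (norm_sub_le _ _).trans ?_
      rw [norm_mul, norm_mul]
      gcongr <;> exact b2 _
    have b4 := mul_le_mul b1 b3 (norm_nonneg _) zero_le_two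
    rw [hw] at b4
    have hpos : 0 < (t ^ 2) ^ k := by positivity
    rw [← mul_le_mul_iff_left₀ hpos]
    refine b4.trans (le_of_eq ?_)
    simp only [Function.comp]
    field_simp
    ring
  have hs0 : s ≠ 0 := fun h => hp0 (by rw [← hrs, h, mul_zero])
  exact mul_ne_zero hs0 (decayLim_ne_zero hp hr) (norm_le_zero_iff.mp hW)

/-- The recursion determines f(k+1) from earlier values because 1 - p^{k+1} ≠ 0, and at k = 0 it
involves only f(0) and f(1). The solution space is therefore one-dimensional. -/
lemma eq_zero_of_jac_eq_zero {p μ : ℂ} (hp : ‖p‖ < 1) {f : ℕ → ℂ} (h0 : f 0 = 0)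
    (hf : ∀ k, jac p μ f k = 0) (k : ℕ) : f k = 0 := by
  induction k using Nat.strong_induction_on with
  | _ k ih =>
    cases k with
    | zero => exact h0
    | succ k =>
      have h := hf k
      rw [jac, ih k (by omega), ih (k - 1) (by omega)] at h
      simpa [one_sub_pow_succ_ne_zero hp k] using h

lemma eq_zero_of_jac_eq_zero_of_sqSummable {p r s : ℂ} (hp0 : p ≠ 0) (hp : ‖p‖ < 1)
    (hrs : r * s = p) (hlt : ‖r‖ < ‖s‖) {f : ℕ → ℂ} (hs : SqSummable p f)
    (hf : ∀ k, jac p (r + s - 1 - p) f k = 0) (k : ℕ) : f k = 0 := by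
  have key : ∀ k, f k = f 0 * polySol p r s k := fun k => by
    have := eq_zero_of_jac_eq_zero (μ := r + s - 1 - p) (f := fun k => f k - f 0 * polySol p r s k)
      hp (by simp [polySol_zero hp0]) (fun k => by
        have h1 := hf k
        have h2 := jac_polySol hp0 hp hrs k
        simp only [jac] at h1 h2 ⊢
        linear_combination h1 - f 0 * h2) k
    exact sub_eq_zero.mp this
  have h0 : f 0 = 0 := by
    by_contra h0
    refine not_sqSummable_polySol hp0 hp hrs hlt ?_
    have := hs.mul_bounded (c := fun _ => (f 0)⁻¹) (fun _ => le_rfl)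
    convert this using 2 with k
    rw [key k, inv_mul_cancel_left₀ h0]
  rw [key, h0, zero_mul]

/-- The sequence obtained by applying the Green function. -/
noncomputable def greenSum (p r s : ℂ) (g : ℕ → ℂ) (j : ℕ) : ℂ :=
  ∑' k, (p ^ k)⁻¹ * (green p r s j k * g k)

lemma exists_green_bound {p r s : ℂ} (hp0 : p ≠ 0) (hp : ‖p‖ < 1) (hrs : r * s = p)
    (hlt : ‖r‖ < ‖s‖) : ∃ D, ∀ (g : ℕ → ℂ) (j k : ℕ), ‖(p ^ k)⁻¹ * (green p r s j k * g k)‖ ≤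
      D * √‖p‖ ^ j * ((‖r‖ / √‖p‖) ^ ((j - k) + (k - j)) * (‖g k‖ / √‖p‖ ^ k)) := by
  obtain ⟨hR, hRt⟩ := norm_sq_lt hp0 hrs hlt
  obtain ⟨C, hC⟩ := exists_norm_decaySol_le hp (norm_lt_one_of_lt hp0 hp hrs hlt)
  obtain ⟨C', hC'⟩ := exists_norm_polySol_le hp0 hp hrs hlt
  set t := √‖p‖ with ht
  have ht0 : 0 < t := hR.trans hRt
  have ht2 : ‖p‖ = t ^ 2 := (Real.sq_sqrt (norm_nonneg _)).symm
  -- Writing ‖s‖ as t²/‖r‖ turns the product of decay and growth rates into powers of ‖r‖/t, with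
  -- exponent the distance to the diagonal.
  have hS : ‖s‖ = t ^ 2 / ‖r‖ := by rw [← ht2, ← hrs, norm_mul]; field_simp
  refine ⟨C * C', fun g j k => ?_⟩
  have hb : ∀ m n, ‖decaySol p r m‖ * ‖polySol p r s n‖ ≤ C * ‖r‖ ^ m * (C' * ‖s‖ ^ n) :=
    fun m n => mul_le_mul (hC m) (hC' n) (norm_nonneg _) ((norm_nonneg _).trans (hC m))
  rw [norm_mul, norm_mul, norm_inv, norm_pow, ht2]
  rcases le_total j k with h | h
  · obtain ⟨n, rfl⟩ := Nat.exists_eq_add_of_le h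
    rw [green, if_pos h, norm_mul, Nat.sub_eq_zero_of_le h, Nat.add_sub_cancel_left, zero_add]
    calc _ ≤ ((t ^ 2) ^ (j + n))⁻¹ *
          (C * ‖r‖ ^ (j + n) * (C' * ‖s‖ ^ j) * ‖g (j + n)‖) := by
            gcongr ?_ * (?_ * ?_); exact hb _ _
      _ = _ := by simp only [hS, div_pow, pow_add]; field_simp; ring
  · obtain ⟨n, rfl⟩ := Nat.exists_eq_add_of_le h
    have hg : ‖green p r s (k + n) k‖ = ‖decaySol p r (k + n)‖ * ‖polySol p r s k‖ := by
      rw [green]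
      split_ifs with h'
      · rw [show n = 0 by omega, norm_mul]; rfl
      · rw [norm_mul, mul_comm]
    rw [hg, Nat.sub_eq_zero_of_le h, Nat.add_sub_cancel_left, add_zero]
    calc _ ≤ ((t ^ 2) ^ k)⁻¹ *
          (C * ‖r‖ ^ (k + n) * (C' * ‖s‖ ^ k) * ‖g k‖) := by
            gcongr ?_ * (?_ * ?_); exact hb _ _
      _ = _ := by simp only [hS, div_pow, pow_add]; field_simp

lemma summable_norm_green {p r s : ℂ} (hp0 : p ≠ 0) (hp : ‖p‖ < 1) (hrs : r * s = p)
    (hlt : ‖r‖ < ‖s‖) {g : ℕ → ℂ} (hg : SqSummable p g) (j : ℕ) :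
    Summable fun k => ‖(p ^ k)⁻¹ * (green p r s j k * g k)‖ := by
  obtain ⟨hR, hRt⟩ := norm_sq_lt hp0 hrs hlt
  obtain ⟨D, hD⟩ := exists_green_bound hp0 hp hrs hlt
  have hS := schur_pow_dist (σ := ‖r‖ / √‖p‖) (by positivity)
    ((div_lt_one (hR.trans hRt)).mpr hRt) (fun k => by positivity) (sqSummable_iff.mp hg)
  exact Summable.of_nonneg_of_le (fun k => norm_nonneg _) (fun k => hD g j k)
    ((hS.1 j).mul_left _)

lemma sqSummable_greenSum {p r s : ℂ} (hp0 : p ≠ 0) (hp : ‖p‖ < 1) (hrs : r * s = p)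
    (hlt : ‖r‖ < ‖s‖) {g : ℕ → ℂ} (hg : SqSummable p g) : SqSummable p (greenSum p r s g) := by
  obtain ⟨hR, hRt⟩ := norm_sq_lt hp0 hrs hlt
  obtain ⟨D, hD⟩ := exists_green_bound hp0 hp hrs hlt
  have hS := schur_pow_dist (σ := ‖r‖ / √‖p‖) (by positivity)
    ((div_lt_one (hR.trans hRt)).mpr hRt) (fun k => by positivity) (sqSummable_iff.mp hg)
  have ht0 : 0 < √‖p‖ := hR.trans hRt
  rw [sqSummable_iff]
  refine Summable.of_nonneg_of_le (fun k => by positivity) (fun j => ?_) (hS.2.mul_left (D ^ 2))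
  rw [← mul_pow]
  refine pow_le_pow_left₀ (by positivity) ?_ 2
  rw [div_le_iff₀ (by positivity), mul_right_comm]
  exact tsum_of_norm_bounded ((hS.1 j).hasSum.mul_left _) (hD g j)

lemma jac_greenSum {p r s : ℂ} (hp0 : p ≠ 0) (hp : ‖p‖ < 1) (hrs : r * s = p)
    (hlt : ‖r‖ < ‖s‖) {g : ℕ → ℂ} (hg : SqSummable p g) (j : ℕ) :
    jac p (r + s - 1 - p) (greenSum p r s g) j = -(s * decayLim p r) * g j := by
  have hr := norm_lt_one_of_lt hp0 hp hrs hlt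
  have H : ∀ i, HasSum (fun k => (p ^ k)⁻¹ * (green p r s i k * g k)) (greenSum p r s g i) :=
    fun i => (summable_norm_green hp0 hp hrs hlt hg i).of_norm.hasSum
  have h1 := ((((H (j + 1)).sub (H j)).mul_left (1 - p ^ (j + 1))).sub
    (((H j).sub (H (j - 1))).mul_left (p * (1 - p ^ j)))).sub ((H j).mul_left (r + s - 1 - p))
  refine h1.unique ((hasSum_ite_eq j (-(s * decayLim p r) * g j)).congr_fun fun k => ?_)
  have h2 := jac_green hp0 hp hr hrs j k
  have hk : p ^ k ≠ 0 := pow_ne_zero _ hp0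
  have h3 : (p ^ k)⁻¹ * g k * jac p (r + s - 1 - p) (fun i => green p r s i k) j =
      if k = j then -(s * decayLim p r) * g j else 0 := by
    rw [h2]
    by_cases h : j = k
    · subst h; simp only [if_true]; field_simp
    · rw [if_neg h, if_neg (Ne.symm h), mul_zero]
  rw [← h3]
  simp only [jac]
  ring

variable {q : ℝ}

/-! ### The Jackson measure -/

lemma node_pos (hq0 : 0 < q) (k : ℕ) : 0 < node q k := by rw [node]; positivity

lemma weight_pos (hq0 : 0 < q) (hq1 : q < 1) (k : ℕ) : 0 < (1 - q ^ 2) * node q k :=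
  mul_pos (sub_pos.mpr (pow_lt_one₀ hq0.le hq1 two_ne_zero)) (node_pos hq0 k)

lemma node_strictMono (hq0 : 0 < q) (hq1 : q < 1) : StrictMono (node q) := fun a b h => by
  rw [node, node]
  exact inv_strictAnti₀ (by positivity) (pow_lt_pow_right_of_lt_one₀ hq0 hq1 (by omega))

lemma ofReal_node (q : ℝ) (k : ℕ) : ((node q k : ℝ) : ℂ) = (((q : ℂ) ^ 2) ^ k)⁻¹ := by
  simp [node, pow_mul]

lemma norm_sq_ofReal (q : ℝ) : ‖(q : ℂ) ^ 2‖ = q ^ 2 := by simp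

/-- Every node carries positive mass, so elements of `L2 q` have well-defined values at the nodes
and can be handled as sequences. -/
lemma ae_jackson_iff (hq0 : 0 < q) (hq1 : q < 1) {P : ℝ → Prop} :
    (∀ᵐ x ∂jackson q, P x) ↔ ∀ k, P (node q k) := by
  rw [jackson, Measure.ae_sum_iff]
  refine forall_congr' fun k => ?_
  rw [Measure.ae_ennreal_smul_measure_iff
    (by simpa using weight_pos hq0 hq1 k), ae_dirac_eq]
  rfl

lemma aestronglyMeasurable_jackson (q : ℝ) (f : ℝ → ℂ) : AEStronglyMeasurable f (jackson q) := by
  rw [jackson, aestronglyMeasurable_sum_measure_iff]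
  exact fun k => aestronglyMeasurable_dirac.smul_measure _

lemma integrable_jackson_iff {E : Type*} [NormedAddCommGroup E] [NormedSpace ℝ E]
    (hq0 : 0 < q) (hq1 : q < 1) {f : ℝ → E} :
    Integrable f (jackson q) ↔ Summable fun k => node q k * ‖f (node q k)‖ := by
  have h1 : (1 - q ^ 2) ≠ 0 := (sub_pos.mpr (pow_lt_one₀ hq0.le hq1 two_ne_zero)).ne'
  rw [jackson, integrable_sum_dirac_iff (fun _ => ENNReal.ofReal_ne_top)]
  simp_rw [ENNReal.toReal_ofReal (weight_pos hq0 hq1 _).le, mul_assoc]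
  exact summable_mul_left_iff h1

lemma integral_jackson (hq0 : 0 < q) (hq1 : q < 1) (f : ℝ → ℂ) :
    ∫ x, f x ∂jackson q =
      ∑' k, (1 - (q : ℂ) ^ 2) * ((((q : ℂ) ^ 2) ^ k)⁻¹ * f (node q k)) := by
  rw [jackson, integral_sum_dirac (fun _ => ENNReal.ofReal_ne_top)]
  refine tsum_congr fun k => ?_
  rw [ENNReal.toReal_ofReal (weight_pos hq0 hq1 _).le, Complex.real_smul, Complex.ofReal_mul,
    ofReal_node]
  push_cast
  ring

lemma memLp_jackson_iff (hq0 : 0 < q) (hq1 : q < 1) {f : ℝ → ℂ} :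
    MemLp f 2 (jackson q) ↔ SqSummable ((q : ℂ) ^ 2) fun k => f (node q k) := by
  rw [memLp_two_iff_integrable_sq_norm (aestronglyMeasurable_jackson q f),
    integrable_jackson_iff hq0 hq1, SqSummable]
  refine summable_congr fun k => ?_
  rw [norm_sq_ofReal, ← pow_mul, node]
  simp

lemma sqSummable_coe (hq0 : 0 < q) (hq1 : q < 1) (f : L2 q) :
    SqSummable ((q : ℂ) ^ 2) fun k => f (node q k) :=
  (memLp_jackson_iff hq0 hq1).mp (Lp.memLp f)

lemma L2_ext (hq0 : 0 < q) (hq1 : q < 1) {f g : L2 q} (h : ∀ k, f (node q k) = g (node q k)) :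
    f = g :=
  Lp.ext ((ae_jackson_iff hq0 hq1).mpr h)

lemma exists_L2_of_sqSummable (hq0 : 0 < q) (hq1 : q < 1) {g : ℕ → ℂ}
    (hg : SqSummable ((q : ℂ) ^ 2) g) : ∃ f : L2 q, ∀ k, f (node q k) = g k := by
  have hext : ∀ k, Function.extend (node q) g 0 (node q k) = g k :=
    fun k => (node_strictMono hq0 hq1).injective.extend_apply _ _ _
  have hm : MemLp (Function.extend (node q) g 0) 2 (jackson q) :=
    (memLp_jackson_iff hq0 hq1).mpr (by simpa only [hext] using hg)
  exact ⟨hm.toLp _, fun k => ((ae_jackson_iff hq0 hq1).mp hm.coeFn_toLp k).trans (hext k)⟩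

lemma add_apply_node (hq0 : 0 < q) (hq1 : q < 1) (f g : L2 q) (k : ℕ) :
    (f + g : L2 q) (node q k) = f (node q k) + g (node q k) :=
  (ae_jackson_iff hq0 hq1).mp (Lp.coeFn_add f g) k

lemma sub_apply_node (hq0 : 0 < q) (hq1 : q < 1) (f g : L2 q) (k : ℕ) :
    (f - g : L2 q) (node q k) = f (node q k) - g (node q k) :=
  (ae_jackson_iff hq0 hq1).mp (Lp.coeFn_sub f g) k

lemma smul_apply_node (hq0 : 0 < q) (hq1 : q < 1) (c : ℂ) (f : L2 q) (k : ℕ) :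
    (c • f : L2 q) (node q k) = c * f (node q k) :=
  (ae_jackson_iff hq0 hq1).mp (Lp.coeFn_smul c f) k

/-- Norm convergence gives convergence in measure, hence almost everywhere along a subsequence; this
is enough for the closed graph argument below. -/
lemma exists_subseq_tendsto_node (hq0 : 0 < q) (hq1 : q < 1) {u : ℕ → L2 q} {f : L2 q}
    (h : Tendsto u atTop (𝓝 f)) : ∃ φ : ℕ → ℕ, StrictMono φ ∧
      ∀ k, Tendsto (fun n => u (φ n) (node q k)) atTop (𝓝 (f (node q k))) := by
  obtain ⟨φ, hφ, h1⟩ := (tendstoInMeasure_of_tendsto_Lp h).exists_seq_tendsto_ae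
  exact ⟨φ, hφ, (ae_jackson_iff hq0 hq1).mp h1⟩

/-! ### The radial Laplacian -/

lemma box_apply (hq0 : 0 < q) (hq1 : q < 1) (f : ℝ → ℂ) {x : ℝ} (hx : x ≠ 0) :
    box q f x = ((1 - (q : ℂ) ^ 2 * (x : ℂ)⁻¹) * (f (q⁻¹ * (q⁻¹ * x)) - f x)
      - (q : ℂ) ^ 2 * (1 - (x : ℂ)⁻¹) * (f x - f (q * (q * x)))) / (1 - (q : ℂ) ^ 2) ^ 2 := by
  have hq : (q : ℂ) ≠ 0 := by exact_mod_cast hq0.ne'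
  have hX : (x : ℂ) ≠ 0 := by exact_mod_cast hx
  have hq2 : 1 - (q : ℂ) ^ 2 ≠ 0 := by
    exact_mod_cast (sub_pos.mpr (pow_lt_one₀ hq0.le hq1 two_ne_zero)).ne'
  have e2 : q * (q⁻¹ * x) = x := mul_inv_cancel_left₀ hq0.ne' x
  have e3 : q⁻¹ * (q * x) = x := inv_mul_cancel_left₀ hq0.ne' x
  simp only [box, qD, e2, e3]
  push_cast
  generalize f (q⁻¹ * (q⁻¹ * x)) = a
  generalize f (q * (q * x)) = c
  have d1 : (q : ℂ)⁻¹ * ((q : ℂ)⁻¹ * x) - x = x * (1 - (q : ℂ) ^ 2) / (q : ℂ) ^ 2 := by field_simp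
  have d2 : (x : ℂ) - q * (q * x) = x * (1 - (q : ℂ) ^ 2) := by ring
  have d3 : (q : ℂ)⁻¹ * x - q * x = x * (1 - (q : ℂ) ^ 2) / q := by field_simp
  rw [d1, d2, d3]
  field_simp

lemma box_node (hq0 : 0 < q) (hq1 : q < 1) (f : ℝ → ℂ) (k : ℕ) :
    box q f (node q k) =
      jac ((q : ℂ) ^ 2) 0 (fun k => f (node q k)) k / (1 - (q : ℂ) ^ 2) ^ 2 := by
  have hq : (q : ℂ) ≠ 0 := by exact_mod_cast hq0.ne'
  have e1 : q⁻¹ * (q⁻¹ * node q k) = node q (k + 1) := by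
    simp only [node, mul_add, pow_add]; field_simp
  rw [box_apply hq0 hq1 f (node_pos hq0 k).ne', e1, ofReal_node, inv_inv, ← pow_succ']
  congr 1
  simp only [jac, zero_mul, sub_zero]
  cases k with
  -- At x = 1 the factor 1 - x⁻¹ vanishes on the left and 1 - p^0 on the right, so neither f(q²) nor
  -- the truncated index matters.
  | zero => simp
  | succ n =>
    have e4 : q * (q * node q (n + 1)) = node q n := by
      simp only [node, mul_add, pow_add]; field_simp
    rw [e4, Nat.add_sub_cancel]

lemma memLp_box (hq0 : 0 < q) (hq1 : q < 1) (f : L2 q) : MemLp (box q f) 2 (jackson q) := by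
  have hp0 : (q : ℂ) ^ 2 ≠ 0 := pow_ne_zero _ (by exact_mod_cast hq0.ne')
  have hp : ‖(q : ℂ) ^ 2‖ < 1 := by rw [norm_sq_ofReal]; exact pow_lt_one₀ hq0.le hq1 two_ne_zero
  rw [memLp_jackson_iff hq0 hq1]
  have := ((sqSummable_coe hq0 hq1 f).jac hp0 hp 0).mul_bounded
    (c := fun _ => ((1 - (q : ℂ) ^ 2) ^ 2)⁻¹) (fun _ => le_rfl)
  convert this using 2 with k
  rw [box_node hq0 hq1, div_eq_inv_mul]

lemma toLp_box_node (hq0 : 0 < q) (hq1 : q < 1) (f : L2 q) (k : ℕ) :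
    (memLp_box hq0 hq1 f).toLp (box q f) (node q k) =
      jac ((q : ℂ) ^ 2) 0 (fun k => f (node q k)) k / (1 - (q : ℂ) ^ 2) ^ 2 :=
  ((ae_jackson_iff hq0 hq1).mp (memLp_box hq0 hq1 f).coeFn_toLp k).trans (box_node hq0 hq1 f k)

/-- `□⁽⁰⁾` as a linear map. -/
noncomputable def boxLinear (hq0 : 0 < q) (hq1 : q < 1) : L2 q →ₗ[ℂ] L2 q where
  toFun f := (memLp_box hq0 hq1 f).toLp (box q f)
  map_add' f g := L2_ext hq0 hq1 fun k => by
    simp only [add_apply_node hq0 hq1, toLp_box_node hq0 hq1, jac]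
    ring
  map_smul' c f := L2_ext hq0 hq1 fun k => by
    simp only [smul_apply_node hq0 hq1, toLp_box_node hq0 hq1, jac, RingHom.id_apply]
    ring

/-- By the closed graph theorem no norm estimate is needed: each value of the image depends on at
most three values of f, so pointwise limits identify it. -/
lemma continuous_boxLinear (hq0 : 0 < q) (hq1 : q < 1) : Continuous (boxLinear hq0 hq1) := by
  refine LinearMap.continuous_of_seq_closed_graph _ fun u f g hu hg => L2_ext hq0 hq1 fun k => ?_
  obtain ⟨φ, hφ, h1⟩ := exists_subseq_tendsto_node hq0 hq1 hu
  obtain ⟨χ, hχ, h2⟩ := exists_subseq_tendsto_node hq0 hq1 (hg.comp hφ.tendsto_atTop)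
  have h3 : ∀ j, Tendsto (fun n => u (φ (χ n)) (node q j)) atTop (𝓝 (f (node q j))) :=
    fun j => (h1 j).comp hχ.tendsto_atTop
  refine tendsto_nhds_unique (h2 k) ?_
  change Tendsto (fun n => (memLp_box hq0 hq1 (u (φ (χ n)))).toLp _ (node q k)) atTop
    (𝓝 ((memLp_box hq0 hq1 f).toLp _ (node q k)))
  simp only [toLp_box_node hq0 hq1, jac]
  exact ((((((h3 _).sub (h3 _)).const_mul _).sub (((h3 _).sub (h3 _)).const_mul _))).sub
    ((h3 _).const_mul _)).div_const _

lemma exists_isRadialLaplacian (hq0 : 0 < q) (hq1 : q < 1) :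
    ∃ B : L2 q →L[ℂ] L2 q, IsRadialLaplacian q B :=
  ⟨⟨boxLinear hq0 hq1, continuous_boxLinear hq0 hq1⟩, fun f => (memLp_box hq0 hq1 f).coeFn_toLp⟩

/-! ### The resolvent -/

section Resolvent

variable {r s : ℂ} {B : L2 q →L[ℂ] L2 q}

lemma sub_smul_apply_node (hq0 : 0 < q) (hq1 : q < 1) (hB : IsRadialLaplacian q B) (μ : ℂ)
    (f : L2 q) (k : ℕ) :
    (B - (μ / (1 - (q : ℂ) ^ 2) ^ 2) • (1 : L2 q →L[ℂ] L2 q)) f (node q k) =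
      jac ((q : ℂ) ^ 2) μ (fun k => f (node q k)) k / (1 - (q : ℂ) ^ 2) ^ 2 := by
  rw [sub_apply, smul_apply,
    one_apply_eq_self, sub_apply_node hq0 hq1, smul_apply_node hq0 hq1,
    (ae_jackson_iff hq0 hq1).mp (hB f), box_node hq0 hq1]
  simp only [jac]
  ring

/-- Injectivity is the absence of square summable homogeneous solutions, surjectivity is the Green
function, and the open mapping theorem supplies boundedness of the inverse. -/
lemma isUnit_and_inverse_apply (hq0 : 0 < q) (hq1 : q < 1) (hrs : r * s = (q : ℂ) ^ 2)
    (hlt : ‖r‖ < ‖s‖) (hB : IsRadialLaplacian q B) {T : L2 q →L[ℂ] L2 q}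
    (hT : T = B - ((r + s - 1 - (q : ℂ) ^ 2) / (1 - (q : ℂ) ^ 2) ^ 2) •
      (1 : L2 q →L[ℂ] L2 q)) :
    IsUnit T ∧ ∀ (g : L2 q) (j : ℕ), Ring.inverse T g (node q j) =
      -((1 - (q : ℂ) ^ 2) ^ 2 / (s * decayLim ((q : ℂ) ^ 2) r)) *
        greenSum ((q : ℂ) ^ 2) r s (fun k => g (node q k)) j := by
  have hp0 : (q : ℂ) ^ 2 ≠ 0 := pow_ne_zero _ (by exact_mod_cast hq0.ne')
  have hp : ‖(q : ℂ) ^ 2‖ < 1 := by rw [norm_sq_ofReal]; exact pow_lt_one₀ hq0.le hq1 two_ne_zero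
  have hp1 : 1 - (q : ℂ) ^ 2 ≠ 0 := by simpa using one_sub_pow_succ_ne_zero hp 0
  have hs0 : s ≠ 0 := fun h => hp0 (by rw [← hrs, h, mul_zero])
  have hL := decayLim_ne_zero hp (norm_lt_one_of_lt hp0 hp hrs hlt)
  have hTk : ∀ f k, T f (node q k) = _ := fun f k => by
    rw [hT, sub_smul_apply_node hq0 hq1 hB]
  have hinj : Function.Injective T := by
    rw [injective_iff_map_eq_zero]
    intro f hf
    have h0 : ∀ k, (0 : L2 q) (node q k) = 0 := fun k =>
      (ae_jackson_iff hq0 hq1).mp (Lp.coeFn_zero ℂ 2 (jackson q)) k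
    refine L2_ext hq0 hq1 fun k => ?_
    rw [h0]
    refine eq_zero_of_jac_eq_zero_of_sqSummable hp0 hp hrs hlt (sqSummable_coe hq0 hq1 f)
      (fun k => ?_) k
    have := hTk f k
    rw [hf, h0, eq_comm, div_eq_zero_iff] at this
    exact this.resolve_right (pow_ne_zero _ hp1)
  have hsol : ∀ g : L2 q, ∃ h : L2 q, T h = g ∧ ∀ j, h (node q j) =
      -((1 - (q : ℂ) ^ 2) ^ 2 / (s * decayLim ((q : ℂ) ^ 2) r)) *
        greenSum ((q : ℂ) ^ 2) r s (fun k => g (node q k)) j := by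
    intro g
    have hg := sqSummable_coe hq0 hq1 g
    obtain ⟨h, hh⟩ := exists_L2_of_sqSummable hq0 hq1
      ((sqSummable_greenSum hp0 hp hrs hlt hg).mul_bounded
        (c := fun _ => -((1 - (q : ℂ) ^ 2) ^ 2 / (s * decayLim ((q : ℂ) ^ 2) r)))
        (fun _ => le_rfl))
    refine ⟨h, L2_ext hq0 hq1 fun k => ?_, hh⟩
    have hj := jac_greenSum hp0 hp hrs hlt hg k
    rw [hTk h k, div_eq_iff (pow_ne_zero _ hp1)]
    simp only [hh]
    simp only [jac] at hj ⊢
    generalize decayLim ((q : ℂ) ^ 2) r = L at *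
    have hκ : (1 - (q : ℂ) ^ 2) ^ 2 / (s * L) * (s * L) = (1 - (q : ℂ) ^ 2) ^ 2 :=
      div_mul_cancel₀ _ (mul_ne_zero hs0 hL)
    generalize (1 - (q : ℂ) ^ 2) ^ 2 / (s * L) = κ at *
    linear_combination -κ * hj + g (node q k) * hκ
  have hU : IsUnit T := ContinuousLinearMap.isUnit_iff_bijective.mpr
    ⟨hinj, fun g => (hsol g).imp fun _ h => h.1⟩
  refine ⟨hU, fun g j => ?_⟩
  obtain ⟨h, h1, h2⟩ := hsol g
  have : Ring.inverse T g = h := by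
    refine hinj ?_
    rw [h1, ← mul_apply_eq_comp, Ring.mul_inverse_cancel T hU,
      one_apply_eq_self]
  rw [this, h2]

lemma isIntegralKernel_iff (hq0 : 0 < q) (hq1 : q < 1) (hrs : r * s = (q : ℂ) ^ 2)
    (hlt : ‖r‖ < ‖s‖) {R : L2 q →L[ℂ] L2 q} {κ : ℂ}
    (hR : ∀ (g : L2 q) (j : ℕ), R g (node q j) =
      (1 - (q : ℂ) ^ 2) * κ * greenSum ((q : ℂ) ^ 2) r s (fun k => g (node q k)) j)
    (G : ℝ → ℝ → ℂ) :
    IsIntegralKernel q R G ↔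
      ∀ j k, G (node q j) (node q k) = κ * green ((q : ℂ) ^ 2) r s j k := by
  have hp0 : (q : ℂ) ^ 2 ≠ 0 := pow_ne_zero _ (by exact_mod_cast hq0.ne')
  have hp : ‖(q : ℂ) ^ 2‖ < 1 := by rw [norm_sq_ofReal]; exact pow_lt_one₀ hq0.le hq1 two_ne_zero
  have hp1 : 1 - (q : ℂ) ^ 2 ≠ 0 := by simpa using one_sub_pow_succ_ne_zero hp 0
  constructor
  · intro h j k
    -- Applying the operator to the indicator of the node k isolates one kernel value, which proves
    -- uniqueness.
    have hδ : SqSummable ((q : ℂ) ^ 2) (Pi.single k 1) :=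
      summable_of_ne_finset_zero (s := {k}) fun i hi => by
        rw [Pi.single_eq_of_ne (by simpa using hi)]; simp
    obtain ⟨δ, hδ⟩ := exists_L2_of_sqSummable hq0 hq1 hδ
    have h1 := (ae_jackson_iff hq0 hq1).mp (h δ).2 j
    simp only at h1
    rw [hR, integral_jackson hq0 hq1, greenSum, tsum_eq_single k, tsum_eq_single k] at h1
    · simp only [hδ, Pi.single_eq_same, mul_one] at h1
      have hk : (((q : ℂ) ^ 2) ^ k)⁻¹ ≠ 0 := inv_ne_zero (pow_ne_zero _ hp0)
      refine mul_left_cancel₀ (mul_ne_zero hp1 hk) ?_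
      linear_combination -h1
    · intro i hi; rw [hδ, Pi.single_eq_of_ne hi]; simp
    · intro i hi; rw [hδ, Pi.single_eq_of_ne hi]; simp
  · intro h f
    refine ⟨(ae_jackson_iff hq0 hq1).mpr fun j => ?_, (ae_jackson_iff hq0 hq1).mpr fun j => ?_⟩
    · rw [integrable_jackson_iff hq0 hq1]
      refine ((summable_norm_green hp0 hp hrs hlt (sqSummable_coe hq0 hq1 f) j).mul_left
        ‖κ‖).congr fun k => ?_
      rw [h, ← abs_of_pos (node_pos hq0 k), ← Real.norm_eq_abs, ← Complex.norm_real, ofReal_node,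
        ← norm_mul, ← norm_mul]
      ring_nf
    · simp only
      rw [hR, integral_jackson hq0 hq1, greenSum, ← tsum_mul_left]
      refine tsum_congr fun k => ?_
      rw [h]
      ring

end Resolvent

/-! ### Translation of the parameters -/

lemma psiSol_node (hq0 : 0 < q) (l : ℂ) (k : ℕ) :
    psiSol q l (node q k) = decaySol ((q : ℂ) ^ 2) ((q : ℂ) ^ (-2 * l)) k := by
  have hq : (q : ℂ) ≠ 0 := by exact_mod_cast hq0.ne'
  have e1 : (node q k : ℂ) ^ l = ((q : ℂ) ^ (-2 * l)) ^ k := by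
    rw [Complex.cpow_def_of_ne_zero (by exact_mod_cast (node_pos hq0 k).ne'),
      Complex.cpow_def_of_ne_zero hq, ← Complex.exp_nat_mul, ← Complex.ofReal_log
      (node_pos hq0 k).le, ← Complex.ofReal_log hq0.le, node, Real.log_inv, Real.log_pow]
    congr 1
    push_cast
    ring
  have e2 : (q : ℂ) ^ (-4 * l) = ((q : ℂ) ^ (-2 * l)) ^ 2 := by
    rw [← Complex.cpow_nat_mul]; congr 1; push_cast; ring
  rw [psiSol, decaySol, e1, e2, ofReal_node, inv_inv, ← pow_succ']

lemma fSol_node (l : ℂ) (k : ℕ) :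
    fSol q l (node q k) =
      polySol ((q : ℂ) ^ 2) ((q : ℂ) ^ (-2 * l)) ((q : ℂ) ^ (2 * (l + 1))) k := by
  rw [fSol, polySol, ofReal_node]

lemma cpow_mul_cpow (hq0 : 0 < q) (l : ℂ) :
    (q : ℂ) ^ (-2 * l) * (q : ℂ) ^ (2 * (l + 1)) = (q : ℂ) ^ 2 := by
  have hq : (q : ℂ) ≠ 0 := by exact_mod_cast hq0.ne'
  rw [← Complex.cpow_add _ _ hq, ← Complex.cpow_natCast]
  congr 1
  push_cast
  ring

lemma norm_cpow_lt (hq0 : 0 < q) (hq1 : q < 1) {l : ℂ} (hl : l.re < -1 / 2) :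
    ‖(q : ℂ) ^ (-2 * l)‖ < ‖(q : ℂ) ^ (2 * (l + 1))‖ := by
  rw [Complex.norm_cpow_eq_rpow_re_of_pos hq0, Complex.norm_cpow_eq_rpow_re_of_pos hq0]
  refine Real.rpow_lt_rpow_of_exponent_gt hq0 hq1 ?_
  simp
  linarith

lemma eigenval_eq (hq0 : 0 < q) (l : ℂ) :
    eigenval q l = ((q : ℂ) ^ (-2 * l) + (q : ℂ) ^ (2 * (l + 1)) - 1 - (q : ℂ) ^ 2) /
      (1 - (q : ℂ) ^ 2) ^ 2 := by
  rw [eigenval, show 2 * l + 2 = 2 * (l + 1) by ring]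
  congr 1
  linear_combination -cpow_mul_cpow hq0 l

/-- Here c(-1-l) contains (r/s; p)_∞ = (1 - r/s)(r²; p)_∞, because pr/s = r². The factor 1 - r/s
cancels against [2l+1]_q = (r - s)/(1 - p), leaving the Wronskian constant. -/
lemma cFun_mul_qNum (hq0 : 0 < q) (hq1 : q < 1) {l : ℂ} (hl : l.re < -1 / 2) :
    cFun q (-1 - l) * qNum q (2 * l + 1) =
      -((q : ℂ) ^ (2 * (l + 1)) * decayLim ((q : ℂ) ^ 2) ((q : ℂ) ^ (-2 * l))) /
        (1 - (q : ℂ) ^ 2) := by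
  have hq : (q : ℂ) ≠ 0 := by exact_mod_cast hq0.ne'
  have hp0 : (q : ℂ) ^ 2 ≠ 0 := pow_ne_zero _ hq
  have hp : ‖(q : ℂ) ^ 2‖ < 1 := by rw [norm_sq_ofReal]; exact pow_lt_one₀ hq0.le hq1 two_ne_zero
  have hp1 : 1 - (q : ℂ) ^ 2 ≠ 0 := by simpa using one_sub_pow_succ_ne_zero hp 0
  have hrs := cpow_mul_cpow hq0 l
  have hlt := norm_cpow_lt hq0 hq1 hl
  have e1 : (q : ℂ) ^ (2 * (-1 - l + 1)) = (q : ℂ) ^ (-2 * l) := by congr 1; ring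
  have e2 : (q : ℂ) ^ 2 * (q : ℂ) ^ (2 * (2 * (-1 - l) + 1)) = ((q : ℂ) ^ (-2 * l)) ^ 2 := by
    rw [← Complex.cpow_nat_mul, ← Complex.cpow_natCast, ← Complex.cpow_add _ _ hq]
    congr 1
    push_cast
    ring
  have e3 : (q : ℂ) * (q : ℂ) ^ (-(2 * l + 1)) = (q : ℂ) ^ (-2 * l) := by
    nth_rewrite 1 [← Complex.cpow_one (q : ℂ)]
    rw [← Complex.cpow_add _ _ hq]
    congr 1
    ring
  have e4 : (q : ℂ) * (q : ℂ) ^ (2 * l + 1) = (q : ℂ) ^ (2 * (l + 1)) := by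
    nth_rewrite 1 [← Complex.cpow_one (q : ℂ)]
    rw [← Complex.cpow_add _ _ hq]
    congr 1
    ring
  have hr := norm_lt_one_of_lt hp0 hp hrs hlt
  have hL := decayLim_ne_zero hp hr
  rw [cFun, qNum, qPochInf_eq_mul hp ((q : ℂ) ^ (2 * (2 * (-1 - l) + 1))), e1, e2, decayLim]
  have hr2 : ‖((q : ℂ) ^ (-2 * l)) ^ 2‖ < 1 := by
    rw [norm_pow]; exact pow_lt_one₀ (norm_nonneg _) hr two_ne_zero
  have n1 := qPochInf_ne_zero hr2 hp
  have n2 := qPochInf_ne_zero hp hp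
  have hsr : (q : ℂ) ^ (2 * (l + 1)) - (q : ℂ) ^ (-2 * l) ≠ 0 := fun h => by
    rw [sub_eq_zero.mp h] at hlt; exact lt_irrefl _ hlt
  generalize qPochInf (((q : ℂ) ^ (-2 * l)) ^ 2) ((q : ℂ) ^ 2) = A at *
  generalize qPochInf ((q : ℂ) ^ 2) ((q : ℂ) ^ 2) = A' at *
  generalize qPochInf ((q : ℂ) ^ (-2 * l)) ((q : ℂ) ^ 2) = A'' at *
  have hs0 : (q : ℂ) ^ (2 * (l + 1)) ≠ 0 := fun h => hp0 (by rw [← hrs, h, mul_zero])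
  have hr0 : (q : ℂ) ^ (-2 * l) ≠ 0 := fun h => hp0 (by rw [← hrs, h, zero_mul])
  have d1 : 1 - (q : ℂ) ^ (2 * (2 * (-1 - l) + 1)) =
      ((q : ℂ) ^ (2 * (l + 1)) - (q : ℂ) ^ (-2 * l)) / (q : ℂ) ^ (2 * (l + 1)) := by
    rw [eq_div_iff hs0]
    refine mul_left_cancel₀ hr0 ?_
    linear_combination (1 - (q : ℂ) ^ (2 * (2 * (-1 - l) + 1))) * hrs - e2 - hrs
  have d2 : ((q : ℂ) ^ (-(2 * l + 1)) - (q : ℂ) ^ (2 * l + 1)) / ((q : ℂ)⁻¹ - (q : ℂ)) =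
      ((q : ℂ) ^ (-2 * l) - (q : ℂ) ^ (2 * (l + 1))) / (1 - (q : ℂ) ^ 2) := by
    rw [← e3, ← e4, show (q : ℂ)⁻¹ - q = (1 - (q : ℂ) ^ 2) / q by field_simp]
    field_simp
  rw [d1, d2]
  generalize (q : ℂ) ^ (-2 * l) = r at *
  generalize (q : ℂ) ^ (2 * (l + 1)) = s at *
  field_simp
  ring

lemma resolvent_of_re_lt (hq0 : 0 < q) (hq1 : q < 1) {B : L2 q →L[ℂ] L2 q}
    (hB : IsRadialLaplacian q B) {l : ℂ} (hl : l.re < -1 / 2) :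
    IsUnit (B - eigenval q l • (1 : L2 q →L[ℂ] L2 q)) ∧
    cFun q (-1 - l) * qNum q (2 * l + 1) ≠ 0 ∧
    ∀ G : ℝ → ℝ → ℂ,
      IsIntegralKernel q (Ring.inverse (B - eigenval q l • (1 : L2 q →L[ℂ] L2 q))) G ↔
        ∀ x ∈ lattice q, ∀ ξ ∈ lattice q,
          G x ξ = c₁ q l *
            (if x ≤ ξ then psiSol q l ξ * fSol q l x else fSol q l ξ * psiSol q l x) := by
  have hp0 : (q : ℂ) ^ 2 ≠ 0 := pow_ne_zero _ (by exact_mod_cast hq0.ne')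
  have hp : ‖(q : ℂ) ^ 2‖ < 1 := by rw [norm_sq_ofReal]; exact pow_lt_one₀ hq0.le hq1 two_ne_zero
  have hp1 : 1 - (q : ℂ) ^ 2 ≠ 0 := by simpa using one_sub_pow_succ_ne_zero hp 0
  have hrs := cpow_mul_cpow hq0 l
  have hlt := norm_cpow_lt hq0 hq1 hl
  have hs0 : (q : ℂ) ^ (2 * (l + 1)) ≠ 0 := fun h => hp0 (by rw [← hrs, h, mul_zero])
  have hL := decayLim_ne_zero hp (norm_lt_one_of_lt hp0 hp hrs hlt)
  obtain ⟨hU, hR⟩ := isUnit_and_inverse_apply hq0 hq1 hrs hlt hB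
    (T := B - eigenval q l • (1 : L2 q →L[ℂ] L2 q)) (by rw [eigenval_eq hq0])
  have hc := cFun_mul_qNum hq0 hq1 hl
  refine ⟨hU, ?_, fun G => ?_⟩
  · rw [hc]
    exact div_ne_zero (neg_ne_zero.mpr (mul_ne_zero hs0 hL)) hp1
  · have hκ : -((1 - (q : ℂ) ^ 2) ^ 2 /
        ((q : ℂ) ^ (2 * (l + 1)) * decayLim ((q : ℂ) ^ 2) ((q : ℂ) ^ (-2 * l)))) =
        (1 - (q : ℂ) ^ 2) * c₁ q l := by
      rw [c₁, hc]
      field_simp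
    rw [hκ] at hR
    rw [isIntegralKernel_iff hq0 hq1 hrs hlt hR]
    simp only [lattice, Set.forall_mem_range, (node_strictMono hq0 hq1).le_iff_le,
      psiSol_node hq0, fSol_node, green]

lemma qNum_neg (q : ℝ) (a : ℂ) : qNum q (-a) = -qNum q a := by
  rw [qNum, qNum, neg_neg]
  ring

lemma eigenval_reflect (q : ℝ) (l : ℂ) : eigenval q (-1 - l) = eigenval q l := by
  rw [eigenval, eigenval, show -2 * (-1 - l) = 2 * l + 2 by ring,
    show 2 * (-1 - l) + 2 = -2 * l by ring]
  ring

lemma fSol_reflect (q : ℝ) (l : ℂ) (x : ℝ) : fSol q (-1 - l) x = fSol q l x := by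
  rw [fSol, fSol, show -2 * (-1 - l) = 2 * (l + 1) by ring,
    show 2 * (-1 - l + 1) = -2 * l by ring, phi32, phi32]
  refine tsum_congr fun m => ?_
  ring

end QDisk

theorem proposition4p11 (q : ℝ) (hq0 : 0 < q) (hq1 : q < 1) :
    (∃ B : QDisk.L2 q →L[ℂ] QDisk.L2 q, QDisk.IsRadialLaplacian q B) ∧
    ∀ B : QDisk.L2 q →L[ℂ] QDisk.L2 q, QDisk.IsRadialLaplacian q B →
      ∀ l : ℂ,
        (l.re < -1 / 2 →
          IsUnit (B - QDisk.eigenval q l • (1 : QDisk.L2 q →L[ℂ] QDisk.L2 q)) ∧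
          QDisk.cFun q (-1 - l) * QDisk.qNum q (2 * l + 1) ≠ 0 ∧
          ∀ G : ℝ → ℝ → ℂ,
            QDisk.IsIntegralKernel q
                (Ring.inverse (B - QDisk.eigenval q l • (1 : QDisk.L2 q →L[ℂ] QDisk.L2 q))) G ↔
              ∀ x ∈ QDisk.lattice q, ∀ ξ ∈ QDisk.lattice q,
                G x ξ = QDisk.c₁ q l *
                  (if x ≤ ξ then QDisk.psiSol q l ξ * QDisk.fSol q l x
                    else QDisk.fSol q l ξ * QDisk.psiSol q l x)) ∧
        (-1 / 2 < l.re →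
          IsUnit (B - QDisk.eigenval q l • (1 : QDisk.L2 q →L[ℂ] QDisk.L2 q)) ∧
          QDisk.cFun q l * QDisk.qNum q (2 * l + 1) ≠ 0 ∧
          ∀ G : ℝ → ℝ → ℂ,
            QDisk.IsIntegralKernel q
                (Ring.inverse (B - QDisk.eigenval q l • (1 : QDisk.L2 q →L[ℂ] QDisk.L2 q))) G ↔
              ∀ x ∈ QDisk.lattice q, ∀ ξ ∈ QDisk.lattice q,
                G x ξ = QDisk.c₂ q l *
                  (if x ≤ ξ then QDisk.psiSol q (-1 - l) ξ * QDisk.fSol q l x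
                    else QDisk.fSol q l ξ * QDisk.psiSol q (-1 - l) x)) := by
  refine ⟨QDisk.exists_isRadialLaplacian hq0 hq1, fun B hB l =>
    ⟨fun hl => QDisk.resolvent_of_re_lt hq0 hq1 hB hl, fun hl => ?_⟩⟩
  -- Under l ↦ -1-l the eigenvalue and f_l are unchanged while [2l+1]_q changes sign, so c₁(-1-l) =
  -- c₂(l).
  have h := QDisk.resolvent_of_re_lt hq0 hq1 hB (l := -1 - l) (by simp; linarith)
  have hn : QDisk.qNum q (2 * (-1 - l) + 1) = -QDisk.qNum q (2 * l + 1) := by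
    rw [← QDisk.qNum_neg]
    congr 1
    ring
  have hc : QDisk.c₁ q (-1 - l) = QDisk.c₂ q l := by
    rw [QDisk.c₁, QDisk.c₂, hn, sub_sub_cancel, mul_neg, one_div_neg_eq_neg_one_div]
  rw [hn, sub_sub_cancel, hc, QDisk.eigenval_reflect, mul_neg, neg_ne_zero] at h
  simpa only [QDisk.fSol_reflect] using h
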